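/- Setting. Let $N\ge 2$ and $d_1,\dots,d_N\in\mathbb N$. For ranks $\mathbf r=(r_1,\dots,r_{N-1})$, with $r_0=r_N=1$, factors $\{X_i\}_{i=1}^N$ consist of matrices $X_i(s)\in\mathbb R^{r_{i-1}\times r_i}$, $1\le s\le d_i$, and $[X_1,\dots,X_N]\in\mathbb R^{d_1\times\cdots\times d_N}$ is the tensor with entries $X_1(s_1)X_2(s_2)\cdots X_N(s_N)$; such a tensor is said to be in TT format with ranks $\mathbf r$. Let $L(X_i)\in\mathbb R^{r_{i-1}d_i\times r_i}$ (resp. $R(X_i)\in\mathbb R^{r_{i-1}\times d_ir_i}$) be the slices $X_i(1),\dots,X_i(d_i)$ stacked vertically (resp. horizontally). Factors are left-orthogonal if $L(X_i)^\top L(X_i)=I_{r_i}$ for $i\le N-1$, and minimal if $\operatorname{rank}L(X_i)=r_i$ and $\operatorname{rank}R(X_i)=r_{i-1}$ for all $i\in\{1,\dots,N\}$. Write $\overline r=\max_{1\le i\le N-1} r_i$, and let $\underline\sigma(\mathcal X)=\min_{1\le i\le N-1}\sigma_{r_i}(\mathcal X^{\langle i\rangle})$, where $\mathcal X^{\langle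 i\rangle}\in\mathbb R^{(d_1\cdots d_i)\times(d_{i+1}\cdots d_N)}$ is the $i$-th unfolding and $\sigma_j$ is the $j$-th largest singular value. Let $\mathcal X^\star=[X_1^\star,\dots,X_N^\star]$ with minimal, left-orthogonal factors $\{X_i^\star\}$ of ranks $\mathbf r$. For factors $\{X_i\}$ of the same sizes put $$\operatorname{dist}^2(\{X_i\},\{X_i^\star\})=\min_{R_1,\dots,R_{N-1}}\ \sum_{i=1}^{N-1}\|\mathcal X^\star\|_F^2\,\|L(X_i)-L_R(X_i^\star)\|_F^2+\|L(X_N)-L_R(X_N^\star)\|_2^2,$$ where each $R_i$ ranges over the orthogonal $r_i\times r_i$ matrices, $R_0=R_N=1$, and $L_R(X_i^\star)$ is the vertical stack of the slices $R_{i-1}^\top X_i^\star(s)R_i$. A linear map $\mathcal A:\mathbb R^{d_1\times\cdots\times d_N}\to\mathbb R^m$ satisfies the $\rho$-RIP with constant $\delta$ if $(1-\delta)\|\mathcal X\|_F^2\le\frac1m\|\mathcal A(\mathcal X)\|_2^2\le(1+\delta)\|\mathcal X\|_F^2$ for every tensor $\mathcal X$ in TT format with all ranks at most $\rho$. Let $y=\mathcal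 A(\mathcal X^\star)$ and $g(X_1,\dots,X_N)=\frac1{2m}\|\mathcal A([X_1,\dots,X_N])-y\|_2^2$. Riemannian gradient descent (RGD) with step size $\mu>0$ is the iteration $$L(X_i^{(t+1)})=\operatorname{Retr}\Big(L(X_i^{(t)})-\tfrac{\mu}{\|\mathcal X^\star\|_F^2}\,\mathcal P_{L(X_i^{(t)})}\big(\nabla_{L(X_i)}g(X_1^{(t)},\dots,X_N^{(t)})\big)\Big),\quad i\le N-1,$$ $$L(X_N^{(t+1)})=L(X_N^{(t)})-\mu\,\nabla_{L(X_N)}g(X_1^{(t)},\dots,X_N^{(t)}),$$ where $\mathcal P_Y(B)=B-\frac12Y(B^\top Y+Y^\top B)$ and $\operatorname{Retr}(Y)=Y(Y^\top Y)^{-1/2}$. Theorem. Assume that $\mathcal A$ satisfies the $(N+3)\overline r$-RIP with constant $\delta\le\frac4{15}$. Let $\{X_i^{(t)}\}_{t\ge0}$ be RGD iterates (with factors of the same sizes as $\{X_i^\star\}$), started from left-orthogonal factors $\{X_i^{(0)}\}$ with $$\operatorname{dist}^2(\{X_i^{(0)}\},\{X_i^\star\})\le\frac{(4-15\delta)\,\underline\sigma^2(\mathcal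 X^\star)}{8\,(N+1+\sum_{i=2}^{N-1}r_i)\,(57N^2+393N-450)},$$ and with step size $0<\mu\le\dfrac{4-15\delta}{10(9N-5)(1+\delta)^2}$. Then the iterates converge linearly to $\{X_i^\star\}$ up to rotation: with $$q=1-\frac{(4-15\delta)\,\underline\sigma^2(\mathcal X^\star)}{320\,(N+1+\sum_{i=2}^{N-1}r_i)\,\|\mathcal X^\star\|_F^2}\,\mu$$ one has $0\le q<1$ and, for every $t\ge0$, $$\operatorname{dist}^2(\{X_i^{(t+1)}\},\{X_i^\star\})\le q\,\operatorname{dist}^2(\{X_i^{(t)}\},\{X_i^\star\}).$$ -/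

import Mathlib

open scoped Matrix

noncomputable section

namespace TT

/-- Bond dimensions `r₀, r₁, …, r_N` of an order-`N` tensor train, with `r₀ = r_N = 1`.
(Values of `dim` beyond `N` are never used.) -/
structure Bonds (N : ℕ) where
  dim : ℕ → ℕ
  first : dim 0 = 1
  last : dim N = 1

/-- The maximum `r̄` of `r₁, …, r_{N-1}`. -/
def Bonds.maxRank {N : ℕ} (r : Bonds N) : ℕ :=
  (Finset.Ico 1 N).sup r.dim

/-- The sum `r₂ + ⋯ + r_{N-1}`. -/
def Bonds.innerSum {N : ℕ} (r : Bonds N) : ℕ :=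
  ∑ k ∈ Finset.Ico 2 N, r.dim k

/-- Real tensors of size `d₁ × ⋯ × d_N`; the Euclidean norm is the Frobenius norm. -/
abbrev Tensor {N : ℕ} (d : Fin N → ℕ) : Type :=
  EuclideanSpace ℝ ((i : Fin N) → Fin (d i))

/-- Tuples of factors: `X i s` is the slice `X_{i+1}(s)`, an `r_i × r_{i+1}` matrix
(the index `i : Fin N` starts at `0`). -/
abbrev Factors {N : ℕ} (d : Fin N → ℕ) (r : Bonds N) : Type :=
  (i : Fin N) → Fin (d i) → Matrix (Fin (r.dim i)) (Fin (r.dim (i + 1))) ℝ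

section Basic

variable {N : ℕ} {d : Fin N → ℕ} {r : Bonds N}

/-- The product `X₁(s₁) X₂(s₂) ⋯ X_k(s_k)` of the first `k` slices. -/
def leftProd (X : Factors d r) (s : (i : Fin N) → Fin (d i)) :
    (k : ℕ) → k ≤ N → Matrix (Fin (r.dim 0)) (Fin (r.dim k)) ℝ
  | 0, _ => 1
  | k + 1, h => leftProd X s k (Nat.le_of_succ_le h) * X ⟨k, h⟩ (s ⟨k, h⟩)

/-- The tensor `[X₁, …, X_N]`: its `(s₁, …, s_N)` entry is the only entry of the `1 × 1` matrix
`X₁(s₁) ⋯ X_N(s_N)`. -/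
def toTensor (X : Factors d r) : Tensor d :=
  WithLp.toLp 2 fun s =>
    leftProd X s N le_rfl ⟨0, by simp [r.first]⟩ ⟨0, by simp [r.last]⟩

/-- Left unfolding: the slices stacked on top of each other. -/
def leftUnf {a b c : ℕ} (Y : Fin b → Matrix (Fin a) (Fin c) ℝ) :
    Matrix (Fin b × Fin a) (Fin c) ℝ :=
  Matrix.of fun p q => Y p.1 p.2 q

/-- Right unfolding: the slices side by side. -/
def rightUnf {a b c : ℕ} (Y : Fin b → Matrix (Fin a) (Fin c) ℝ) :
    Matrix (Fin a) (Fin b × Fin c) ℝ :=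
  Matrix.of fun p q => Y q.1 p q.2

/-- The decomposition is minimal: `L(X_i)` has rank `r_i` and `R(X_i)` has rank `r_{i-1}`
for every `i = 1, …, N`. -/
def IsMinimal (X : Factors d r) : Prop :=
  ∀ i : Fin N, (leftUnf (X i)).rank = r.dim (i + 1) ∧ (rightUnf (X i)).rank = r.dim i

/-- Left-orthogonal form: `L(X_i)ᵀ L(X_i) = I` for `i = 1, …, N-1`. -/
def IsLeftOrthogonal (X : Factors d r) : Prop :=
  ∀ i : Fin N, (i : ℕ) + 1 < N → (leftUnf (X i))ᵀ * leftUnf (X i) = 1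

/-- The `k`-th unfolding of a tensor: rows are indexed by `(s₁, …, s_k)`, columns by
`(s_{k+1}, …, s_N)`. -/
def unfolding (Z : Tensor d) (k : ℕ) :
    Matrix ((i : {i : Fin N // (i : ℕ) < k}) → Fin (d i))
      ((i : {i : Fin N // ¬ (i : ℕ) < k}) → Fin (d i)) ℝ :=
  Matrix.of fun u v =>
    Z ((Equiv.piEquivPiSubtypeProd (fun i : Fin N => (i : ℕ) < k) fun i => Fin (d i)).symm (u, v))

/-- The `j`-th largest singular value of a matrix, `j = 1, 2, …`. -/
def singularValue {m n : Type} [Fintype m] [Fintype n] [DecidableEq m] [DecidableEq n]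
    (M : Matrix m n ℝ) (j : ℕ) : ℝ :=
  (Matrix.toLpLin 2 2 M).singularValues (j - 1)

/-- The smallest singular value of a tensor with TT ranks `r`: the minimum over
`k = 1, …, N-1` of the `r_k`-th singular value of the `k`-th unfolding. -/
def sigmaMin (r : Bonds N) (Z : Tensor d) : ℝ :=
  ⨅ k : Finset.Ico 1 N, singularValue (unfolding Z (k : ℕ)) (r.dim k)

/-- Squared Frobenius norm of a matrix. -/
def frobSq {m n : Type} [Fintype m] [Fintype n] (M : Matrix m n ℝ) : ℝ :=
  ∑ a, ∑ b, M a b ^ 2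

/-- Families of orthogonal matrices `R_k` of size `r_k × r_k` with `R₀ = R_N = 1`
(only `R₀, …, R_N` matter). -/
abbrev Rotations (r : Bonds N) : Type :=
  {R : (k : ℕ) → Matrix.orthogonalGroup (Fin (r.dim k)) ℝ // R 0 = 1 ∧ R N = 1}

/-- The rotated factors, with slices `R_{i-1}ᵀ X_i(s) R_i`. -/
def rotate (R : Rotations r) (X : Factors d r) : Factors d r := fun i s =>
  (R.1 i).1ᵀ * X i s * (R.1 (i + 1)).1

/-- The squared distance of `X` to `Y` up to rotation. The minimum is taken over a nonempty
compact set of families of orthogonal matrices and is written as an infimum. The first `N - 1` factors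
carry the weight `‖[Y₁, …, Y_N]‖_F²`, the last one the weight `1`. -/
def distSq (X Y : Factors d r) : ℝ :=
  ⨅ R : Rotations r, ∑ i : Fin N,
    (if (i : ℕ) + 1 < N then ‖toTensor Y‖ ^ 2 else 1) *
      frobSq (leftUnf (X i) - leftUnf (rotate R Y i))

/-- `A` satisfies the `R`-restricted isometry property with constant `δ`: near-isometry, after
normalisation by `1 / m`, on all TT-format tensors whose ranks are at most `R`. -/
def HasRIP {m : ℕ} (A : Tensor d →ₗ[ℝ] EuclideanSpace ℝ (Fin m)) (R : ℕ) (δ : ℝ) : Prop :=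
  ∀ ρ : Bonds N, (∀ k : ℕ, 1 ≤ k → k < N → ρ.dim k ≤ R) →
    ∀ Z : Factors d ρ,
      (1 - δ) * ‖toTensor Z‖ ^ 2 ≤ 1 / (m : ℝ) * ‖A (toTensor Z)‖ ^ 2 ∧
        1 / (m : ℝ) * ‖A (toTensor Z)‖ ^ 2 ≤ (1 + δ) * ‖toTensor Z‖ ^ 2

/-- The loss `g(X₁, …, X_N) = ‖A([X₁, …, X_N]) - y‖² / (2m)`. -/
def loss {m : ℕ} (A : Tensor d →ₗ[ℝ] EuclideanSpace ℝ (Fin m)) (y : EuclideanSpace ℝ (Fin m))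
    (X : Factors d r) : ℝ :=
  1 / (2 * (m : ℝ)) * ‖A (toTensor X) - y‖ ^ 2

/-- The gradient of `g` with respect to all factors: the `(a, b)` entry of slice `s` of the
`i`-th factor is the partial derivative of `g` in the entry `(a, b)` of `X_i(s)`. -/
def gradient (g : Factors d r → ℝ) (X : Factors d r) : Factors d r := fun i s =>
  Matrix.of fun a b => lineDeriv ℝ g X (Pi.single i (Pi.single s (Matrix.single a b 1)))

end Basic

section Stiefel

variable {m n : Type} [Fintype m] [Fintype n] [DecidableEq n]

/-- Projection of `B` onto the tangent space of the Stiefel manifold at `Y`. -/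
def tangentProj (Y B : Matrix m n ℝ) : Matrix m n ℝ :=
  B - (1 / 2 : ℝ) • (Y * (Bᵀ * Y + Yᵀ * B))

/-- Polar retraction `Y (Yᵀ Y)^{-1/2}`, the power being taken by functional calculus. -/
def retract (Y : Matrix m n ℝ) : Matrix m n ℝ :=
  Y * cfc (fun x : ℝ => x ^ (-(1 / 2) : ℝ)) (Yᵀ * Y)

end Stiefel

/-- The sequence `X 0, X 1, …` of factors is generated by Riemannian gradient descent for the
objective `g`: step size `μ / c` with tangent projection and polar retraction for the first
`N - 1` factors, plain gradient steps of size `μ` for the last one. -/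
def IsRGD {N : ℕ} {d : Fin N → ℕ} {r : Bonds N} (g : Factors d r → ℝ) (c μ : ℝ)
    (X : ℕ → Factors d r) : Prop :=
  ∀ (t : ℕ) (i : Fin N),
    ((i : ℕ) + 1 < N →
      leftUnf (X (t + 1) i) =
        retract (leftUnf (X t i) -
          (μ / c) • tangentProj (leftUnf (X t i)) (leftUnf (gradient g (X t) i)))) ∧
    ((i : ℕ) + 1 = N →
      leftUnf (X (t + 1) i) = leftUnf (X t i) - μ • leftUnf (gradient g (X t) i))

end TT

end

/-! Fix an iterate `X` and choose rotations attaining its distance to the target factors `Y`; let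
`V` be the rotated target, which represents the same tensor and is still left-orthogonal. Since the
next distance is an infimum, it suffices to show that one step contracts the weighted squared error
to this fixed `V`.

Write `H` for the tensor error, `h = ‖H‖`, `D` for the weighted squared factor error and `s` for the
squared norm of the target. A tangent step makes the Gram matrix of a factor at least the identity,
so the polar retraction cannot move it away from `V` (`frobSq_retract_sub_le`), and each factor
obeys the usual gradient-descent inequality. Summed over the factors, the linear terms pair the
sensed error with the first-order expansion of the tensor train at `X` in the direction `X - V`.
Telescoping twice (`sum_slotMap_eq`) shows that this expansion is `H` plus products of two factor
errors; projecting `X_i - V_i` adds another quadratic error. Left-orthogonality bounds the total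
effect by a multiple of `h * N * D / √s` (`sensing_lower_bound`), while the restricted isometry
property makes the leading term at least `(1 - δ) * h ^ 2`. Cross terms only need Cauchy–Schwarz
with factor `1 + δ`.

What remains is to compare `D` with `h ^ 2`. The reverse bound `sq_mul_distSq_le` says that close
tensors have close factors: `σ ^ 2 * D ≤ 8 * Q * s * h ^ 2`, with `Q = N + 1 + r₂ + ⋯ + r_{N-1}`. It
holds because the singular gap `σ` forces the column spaces of the unfoldings to be close, and polar
factors of the interface Gram matrices then align all bonds independently. Used once together with
the smallness of `D`, this bound absorbs the quadratic terms; used a second time, it turns the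
decrease of order `μ * h ^ 2` into a fixed fraction of `D`. The distance therefore decreases, the
iterates stay in the initial neighbourhood, and induction gives linear convergence. -/

noncomputable section

/-! ### Positive semidefinite real matrices -/

theorem Matrix.PosSemidef.exists_eq_transpose_mul_self {n : Type*} [Fintype n]
    {A : Matrix n n ℝ} (hA : A.PosSemidef) : ∃ S : Matrix n n ℝ, A = Sᵀ * S := by
  classical
  have hc : ∀ g : ℝ → ℝ, ContinuousOn g (spectrum ℝ A) := fun g =>
    (Matrix.finite_real_spectrum (A := A)).continuousOn g
  have h0 := (Matrix.posSemidef_iff_isHermitian_and_spectrum_nonneg.mp hA).2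
  have hsa : IsSelfAdjoint A := hA.isHermitian
  have h2 : (cfc (fun x => √x) A)ᴴ = cfc (fun x => √x) A :=
    cfc_predicate (p := IsSelfAdjoint) _ A
  rw [Matrix.conjTranspose_eq_transpose_of_trivial] at h2
  refine ⟨cfc (fun x => √x) A, ?_⟩
  rw [h2, ← cfc_mul _ _ A (hc _) (hc _)]
  conv_lhs => rw [← cfc_id ℝ A]
  exact cfc_congr fun x hx => (Real.mul_self_sqrt (h0 hx)).symm

theorem Matrix.PosSemidef.trace_mul_nonneg {n : Type*} [Fintype n] {A B : Matrix n n ℝ}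
    (hA : A.PosSemidef) (hB : B.PosSemidef) : 0 ≤ (A * B).trace := by
  obtain ⟨S, rfl⟩ := hA.exists_eq_transpose_mul_self
  rw [Matrix.mul_assoc, Matrix.trace_mul_comm]
  have := (hB.mul_mul_conjTranspose_same S).trace_nonneg
  rwa [Matrix.conjTranspose_eq_transpose_of_trivial] at this

theorem Matrix.PosSemidef.cfc_of_nonneg {n : Type*} [Fintype n] [DecidableEq n]
    (M : Matrix n n ℝ) (f : ℝ → ℝ) (hf : ∀ x ∈ spectrum ℝ M, 0 ≤ f x) :
    (cfc f M).PosSemidef := by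
  have hc : ∀ g : ℝ → ℝ, ContinuousOn g (spectrum ℝ M) := fun g =>
    (Matrix.finite_real_spectrum (A := M)).continuousOn g
  have h1 : cfc f M = cfc (fun x => √(f x)) M * cfc (fun x => √(f x)) M := by
    rw [← cfc_mul _ _ M (hc _) (hc _)]
    exact cfc_congr fun x hx => (Real.mul_self_sqrt (hf x hx)).symm
  have h2 : (cfc (fun x => √(f x)) M)ᴴ = cfc (fun x => √(f x)) M := cfc_predicate (p := IsSelfAdjoint) _ M
  rw [h1]
  nth_rewrite 1 [← h2]
  exact Matrix.posSemidef_conjTranspose_mul_self _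

namespace TT

/-! ### Polar decomposition -/

section Polar

variable {m n : Type} [Fintype m] [Fintype n] [DecidableEq n]

/-- The matrix `S` is `(Yᵀ Y)^{1/2}` from functional calculus on the positive spectrum. This
packages everything needed about the polar factor, so that later arguments never return to the
spectrum; the last clause is monotonicity of the square root at `1`. -/
theorem exists_retract_mul_eq (Y : Matrix m n ℝ) (h : (Yᵀ * Y).PosDef) :
    ∃ S : Matrix n n ℝ, S.PosSemidef ∧ retract Y * S = Y ∧ S * S = Yᵀ * Y ∧
      (retract Y)ᵀ * retract Y = 1 ∧ (retract Y)ᵀ * Y = S ∧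
      ((Yᵀ * Y - 1).PosSemidef → (S - 1).PosSemidef) := by
  set M := Yᵀ * Y with hM
  have hH : M.IsHermitian := h.isHermitian
  have hsa : IsSelfAdjoint M := hH
  have hc : ∀ g : ℝ → ℝ, ContinuousOn g (spectrum ℝ M) := fun g =>
    (Matrix.finite_real_spectrum (A := M)).continuousOn g
  have hpos : ∀ x ∈ spectrum ℝ M, 0 < x := by
    intro x hx
    rw [hH.spectrum_real_eq_range_eigenvalues] at hx
    obtain ⟨i, rfl⟩ := hx
    exact h.eigenvalues_pos i
  set f : ℝ → ℝ := fun x : ℝ => x ^ (-(1 / 2) : ℝ) with hf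
  set T := cfc f M with hT
  set S := cfc (fun x : ℝ => √x) M with hS
  have hfs : ∀ x ∈ spectrum ℝ M, f x * √x = 1 := by
    intro x hx
    have := hpos x hx
    rw [hf, Real.sqrt_eq_rpow]
    simp only
    rw [← Real.rpow_add this]; norm_num
  have hTS : T * S = 1 := by
    rw [hT, hS, ← cfc_mul _ _ M (hc _) (hc _), ← cfc_const_one ℝ M]
    exact cfc_congr hfs
  have hST : S * T = 1 := by
    rw [hT, hS, ← cfc_mul _ _ M (hc _) (hc _), ← cfc_const_one ℝ M]
    exact cfc_congr fun x hx => by rw [mul_comm]; exact hfs x hx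
  have hSS : S * S = M := by
    rw [hS, ← cfc_mul _ _ M (hc _) (hc _)]
    conv_rhs => rw [← cfc_id ℝ M]
    exact cfc_congr fun x hx => Real.mul_self_sqrt (hpos x hx).le
  have hTt : Tᵀ = T := by
    have : Tᴴ = T := cfc_predicate (p := IsSelfAdjoint) f M
    simpa [Matrix.conjTranspose_eq_transpose_of_trivial] using this
  have hr : retract Y = Y * T := rfl
  refine ⟨S, Matrix.PosSemidef.cfc_of_nonneg M _ fun x _ => Real.sqrt_nonneg x, ?_, hSS, ?_, ?_, ?_⟩
  · rw [hr, Matrix.mul_assoc, hTS, Matrix.mul_one]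
  · rw [hr, Matrix.transpose_mul, hTt, Matrix.mul_assoc, ← Matrix.mul_assoc Yᵀ, ← hM, ← hSS,
      Matrix.mul_assoc, hST, Matrix.mul_one, hTS]
  · rw [hr, Matrix.transpose_mul, hTt, Matrix.mul_assoc, ← hM, ← hSS, ← Matrix.mul_assoc, hTS,
      Matrix.one_mul]
  · intro h1
    have hS1 : S - 1 = cfc (fun x : ℝ => √x - 1) M := by
      rw [cfc_sub _ _ M (hc _) (hc _), cfc_const_one ℝ M]
    rw [hS1]
    refine Matrix.PosSemidef.cfc_of_nonneg M _ fun x hx => ?_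
    have h2 := (Matrix.posSemidef_iff_isHermitian_and_spectrum_nonneg.mp h1).2
    have h3 : x - 1 ∈ spectrum ℝ (M - 1) := by
      rw [← map_one (algebraMap ℝ (Matrix n n ℝ)), ← spectrum.sub_singleton_eq]
      exact Set.sub_mem_sub hx rfl
    have h4 : 0 ≤ x - 1 := h2 h3
    have := Real.one_le_sqrt.mpr (show 1 ≤ x by linarith)
    linarith

end Polar

/-! ### Frobenius norm identities -/

theorem frobSq_eq_trace {m n : Type} [Fintype m] [Fintype n] (M : Matrix m n ℝ) :
    frobSq M = (Mᵀ * M).trace := by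
  simp only [frobSq, Matrix.trace, Matrix.diag, Matrix.mul_apply, Matrix.transpose_apply]
  rw [Finset.sum_comm]
  simp [sq]

theorem frobSq_nonneg {m n : Type} [Fintype m] [Fintype n] (M : Matrix m n ℝ) : 0 ≤ frobSq M :=
  Finset.sum_nonneg fun _ _ => Finset.sum_nonneg fun _ _ => sq_nonneg _

theorem frobSq_mul_le {l m n : Type} [Fintype l] [Fintype m] [Fintype n]
    (A : Matrix l m ℝ) (B : Matrix m n ℝ) : frobSq (A * B) ≤ frobSq A * frobSq B := by
  have h : ∀ a b, (A * B) a b ^ 2 ≤ (∑ k, A a k ^ 2) * ∑ k, B k b ^ 2 := fun a b => by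
    rw [Matrix.mul_apply]; exact Finset.sum_mul_sq_le_sq_mul_sq _ _ _
  calc frobSq (A * B) ≤ ∑ a, ∑ b, (∑ k, A a k ^ 2) * ∑ k, B k b ^ 2 :=
        Finset.sum_le_sum fun a _ => Finset.sum_le_sum fun b _ => h a b
    _ = frobSq A * frobSq B := by
        simp only [frobSq]
        rw [Finset.sum_comm (f := fun k b => B k b ^ 2), Finset.sum_mul_sum]

/-- Self-adjointness of the projection: it moves the projection from the gradient onto the factor
error, where it can be computed. -/
theorem trace_transpose_mul_tangentProj {m n : Type} [Fintype m] [Fintype n] (Y B C : Matrix m n ℝ) :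
    (Cᵀ * tangentProj Y B).trace = ((tangentProj Y C)ᵀ * B).trace := by
  have h1 : (Cᵀ * (Y * (Bᵀ * Y))).trace = (Yᵀ * C * (Yᵀ * B)).trace := by
    rw [← Matrix.trace_transpose]
    simp only [Matrix.transpose_mul, Matrix.transpose_transpose]
    rw [Matrix.trace_mul_comm (Yᵀ * C)]
    simp only [Matrix.mul_assoc]
  have h2 : (Cᵀ * (Y * (Yᵀ * B))).trace = (Cᵀ * Y * (Yᵀ * B)).trace := by
    rw [Matrix.mul_assoc]
  simp only [tangentProj, Matrix.mul_sub, Matrix.transpose_sub, Matrix.sub_mul, Matrix.trace_sub,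
    Matrix.mul_smul, Matrix.transpose_smul, Matrix.smul_mul, Matrix.trace_smul, Matrix.mul_add,
    Matrix.transpose_mul, Matrix.transpose_add, Matrix.trace_add, Matrix.add_mul, h1, h2,
    Matrix.transpose_transpose]
  rw [Matrix.mul_assoc (Yᵀ * C), Matrix.mul_assoc (Cᵀ * Y)]

/-! ### Geometry of the Stiefel manifold and singular values -/

section Stiefel

variable {m n : Type} [Fintype m] [Fintype n] [DecidableEq n]

/-- A polar retraction of `Y` with `YᵀY ≥ 1` does not increase distances to the Stiefel manifold. -/
theorem frobSq_retract_sub_le (Y W : Matrix m n ℝ) (hY : (Yᵀ * Y - 1).PosSemidef)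
    (hW : Wᵀ * W = 1) :
    (retract Y)ᵀ * retract Y = 1 ∧ frobSq (retract Y - W) ≤ frobSq (Y - W) := by
  have hpd : (Yᵀ * Y).PosDef := by
    have := Matrix.PosDef.posSemidef_add hY Matrix.PosDef.one
    simpa using this
  obtain ⟨S, hS, hQS, hSS, hQQ, hQY, hS1⟩ := exists_retract_mul_eq Y hpd
  refine ⟨hQQ, ?_⟩
  set Q := retract Y
  have hS1 := hS1 hY
  have hSt : Sᵀ = S := by simpa [Matrix.conjTranspose_eq_transpose_of_trivial] using hS.isHermitian.eq
  -- With `S = Qᵀ Y`, the decrease `‖Y - W‖² - ‖Q - W‖²` equals `tr ((S - 1)(Q - W)ᵀ(Q - W)) + tr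
  -- ((S - 1)²)`; both traces are nonnegative because `S ≥ 1`.
  have h1 := hS1.trace_mul_nonneg (Matrix.posSemidef_conjTranspose_mul_self (Q - W))
  have h2 := hS1.trace_mul_nonneg hS1
  rw [Matrix.conjTranspose_eq_transpose_of_trivial] at h1
  have e1 : ((S - 1) * ((Q - W)ᵀ * (Q - W))).trace
      = 2 * S.trace - 2 * (Wᵀ * Q * S).trace - 2 * (1 : Matrix n n ℝ).trace + 2 * (Wᵀ * Q).trace := by
    have : (Q - W)ᵀ * (Q - W) = 2 • (1 : Matrix n n ℝ) - Wᵀ * Q - (Wᵀ * Q)ᵀ := by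
      simp only [Matrix.transpose_sub, Matrix.sub_mul, Matrix.mul_sub, hQQ, hW,
        Matrix.transpose_mul, Matrix.transpose_transpose]
      abel
    have h3 : (S * (Wᵀ * Q)ᵀ).trace = (Wᵀ * Q * S).trace := by
      rw [← Matrix.trace_transpose, Matrix.transpose_mul, Matrix.transpose_transpose, hSt]
    have h4 : (S * (Wᵀ * Q)).trace = (Wᵀ * Q * S).trace := Matrix.trace_mul_comm _ _
    rw [this]
    simp only [Matrix.sub_mul, Matrix.mul_sub, Matrix.trace_sub, h3, h4, Matrix.one_mul,
      Matrix.trace_transpose, Matrix.mul_smul, Matrix.mul_one, Matrix.trace_smul]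
    simp
    ring
  have e2 : frobSq (Y - W) = (S * S).trace - 2 * (Wᵀ * Q * S).trace + (1 : Matrix n n ℝ).trace := by
    rw [frobSq_eq_trace]
    have h3 : (Yᵀ * W).trace = (Wᵀ * Y).trace := by
      rw [← Matrix.trace_transpose, Matrix.transpose_mul, Matrix.transpose_transpose]
    simp only [Matrix.transpose_sub, Matrix.sub_mul, Matrix.mul_sub, Matrix.trace_sub, h3, hW, ← hSS]
    rw [Matrix.mul_assoc, hQS]; ring
  have e3 : frobSq (Q - W) = 2 * (1 : Matrix n n ℝ).trace - 2 * (Wᵀ * Q).trace := by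
    rw [frobSq_eq_trace]
    have h3 : (Qᵀ * W).trace = (Wᵀ * Q).trace := by
      rw [← Matrix.trace_transpose, Matrix.transpose_mul, Matrix.transpose_transpose]
    simp only [Matrix.transpose_sub, Matrix.sub_mul, Matrix.mul_sub, Matrix.trace_sub, h3, hW, hQQ]
    ring
  have e4 : ((S - 1) * (S - 1)).trace = (S * S).trace - 2 * S.trace + (1 : Matrix n n ℝ).trace := by
    simp only [Matrix.sub_mul, Matrix.mul_sub, Matrix.trace_sub, Matrix.one_mul, Matrix.mul_one]
    ring
  linarith

/-- With `K = Bᵀ Y + Yᵀ B` symmetric, the projection removes exactly `‖K‖² / 4` from `‖B‖²`. -/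
theorem frobSq_tangentProj_le (Y B : Matrix m n ℝ) (hY : Yᵀ * Y = 1) :
    frobSq (tangentProj Y B) ≤ frobSq B := by
  set K := Bᵀ * Y + Yᵀ * B with hK
  have hKt : Kᵀ = K := by
    rw [hK, Matrix.transpose_add, Matrix.transpose_mul, Matrix.transpose_mul,
      Matrix.transpose_transpose, Matrix.transpose_transpose, add_comm]
  have hP : tangentProj Y B = B - (1 / 2 : ℝ) • (Y * K) := rfl
  have h1 : (Bᵀ * (Y * K)).trace + ((Y * K)ᵀ * B).trace = (K * K).trace := by
    rw [Matrix.transpose_mul, hKt, Matrix.mul_assoc, ← Matrix.mul_assoc, Matrix.trace_mul_comm,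
      ← Matrix.trace_add, ← Matrix.mul_add]
  have h2 : ((Y * K)ᵀ * (Y * K)).trace = (K * K).trace := by
    rw [Matrix.transpose_mul, hKt, Matrix.mul_assoc, ← Matrix.mul_assoc Yᵀ, hY, Matrix.one_mul]
  have h3 : 0 ≤ (K * K).trace := by
    have := frobSq_nonneg K
    rwa [frobSq_eq_trace, hKt] at this
  rw [frobSq_eq_trace, frobSq_eq_trace, hP]
  simp only [Matrix.mul_sub, Matrix.transpose_sub, Matrix.sub_mul, Matrix.trace_sub,
    Matrix.mul_smul, Matrix.transpose_smul, Matrix.smul_mul, Matrix.trace_smul, h2, smul_eq_mul]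
  linarith

/-- A step along a tangent direction of the Stiefel manifold. -/
theorem posSemidef_sub_smul_tangentProj (Y B : Matrix m n ℝ) (hY : Yᵀ * Y = 1) (c : ℝ) :
    ((Y - c • tangentProj Y B)ᵀ * (Y - c • tangentProj Y B) - 1).PosSemidef := by
  set P := tangentProj Y B with hP
  -- Tangency kills the first-order term, so the Gram matrix of the step is `1 + c² Pᵀ P`.
  have h : Pᵀ * Y + Yᵀ * P = 0 := by
    simp only [hP, tangentProj, Matrix.mul_sub, Matrix.transpose_sub, Matrix.sub_mul,
      Matrix.mul_smul, Matrix.transpose_smul, Matrix.smul_mul, Matrix.transpose_mul,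
      Matrix.transpose_add, Matrix.transpose_transpose]
    rw [← Matrix.mul_assoc Yᵀ Y, Matrix.mul_assoc _ Yᵀ Y, hY, Matrix.mul_one, Matrix.one_mul,
      add_comm (Yᵀ * B) (Bᵀ * Y)]
    module
  have e : (Y - c • P)ᵀ * (Y - c • P) - 1 = c ^ 2 • (Pᵀ * P) := by
    have : (Y - c • P)ᵀ * (Y - c • P) = Yᵀ * Y - c • (Pᵀ * Y + Yᵀ * P) + c ^ 2 • (Pᵀ * P) := by
      simp only [Matrix.mul_sub, Matrix.transpose_sub, Matrix.sub_mul,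
      Matrix.mul_smul, Matrix.transpose_smul, Matrix.smul_mul]
      module
    rw [this, hY, h]; simp
  rw [e]
  have := Matrix.posSemidef_conjTranspose_mul_self P
  rw [Matrix.conjTranspose_eq_transpose_of_trivial] at this
  exact this.smul (sq_nonneg c)

/-- For two Stiefel points, `(Y - W)ᵀ Y + Yᵀ (Y - W) = (Y - W)ᵀ (Y - W)`. Hence the projection
alters the error only to second order. -/
theorem tangentProj_sub_stiefel (Y W : Matrix m n ℝ) (hY : Yᵀ * Y = 1) (hW : Wᵀ * W = 1) :
    tangentProj Y (Y - W) = (Y - W) - (1 / 2 : ℝ) • (Y * ((Y - W)ᵀ * (Y - W))) := by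
  simp only [tangentProj]
  congr 3
  simp only [Matrix.mul_sub, Matrix.transpose_sub, Matrix.sub_mul, hY, hW]
  abel

end Stiefel

/-- The `r`-th singular value of `U Z`, where `U` has `r` orthonormal columns, bounds `Z Zᵀ`
from below. -/
theorem posSemidef_mul_transpose_sub_singularValue {m n : Type} [Fintype m] [Fintype n]
    [DecidableEq m] [DecidableEq n] {p : ℕ} (hp : 0 < p) (U : Matrix m (Fin p) ℝ)
    (Z : Matrix (Fin p) n ℝ) (hU : Uᵀ * U = 1) (hZ : ∀ x, x ᵥ* Z = 0 → x = 0) :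
    0 < singularValue (U * Z) p ∧
      (Z * Zᵀ - singularValue (U * Z) p ^ 2 • (1 : Matrix (Fin p) (Fin p) ℝ)).PosSemidef := by
  classical
  set M := U * Z with hM
  set σ := singularValue M p with hσ
  have hMM : Mᵀ * M = Zᵀ * Z := by
    rw [hM, Matrix.transpose_mul, Matrix.mul_assoc, ← Matrix.mul_assoc Uᵀ, hU, Matrix.one_mul]
  set W := Z * Zᵀ with hW
  have hWp : W.PosDef := by
    have := Matrix.PosDef.mul_conjTranspose_self Z fun x y hxy => by
      have h := hZ (x - y) (by rw [Matrix.sub_vecMul]; exact sub_eq_zero.mpr hxy)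
      exact sub_eq_zero.mp h
    rwa [Matrix.conjTranspose_eq_transpose_of_trivial] at this
  have hrank : M.rank = p := by
    refine le_antisymm ?_ ?_
    · calc M.rank ≤ U.rank := Matrix.rank_mul_le_left U Z
        _ ≤ Fintype.card (Fin p) := Matrix.rank_le_card_width U
        _ = p := Fintype.card_fin p
    · have h1 : W = Uᵀ * (M * Zᵀ) := by
        rw [hM, Matrix.mul_assoc, ← Matrix.mul_assoc Uᵀ, hU, Matrix.one_mul]
      have h2 : W.rank = p := by
        rw [Matrix.rank_of_isUnit W hWp.isUnit, Fintype.card_fin]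
      calc p = (Uᵀ * (M * Zᵀ)).rank := by rw [← h1, h2]
        _ ≤ (M * Zᵀ).rank := Matrix.rank_mul_le_right _ _
        _ ≤ M.rank := Matrix.rank_mul_le_left _ _
  set f := Matrix.toLpLin 2 2 M with hf
  have hfr : Module.finrank ℝ (LinearMap.range f) = p := by
    rw [← hrank, Matrix.rank_eq_finrank_range_toLin M (PiLp.basisFun 2 ℝ m) (PiLp.basisFun 2 ℝ n)]
    rfl
  have hadj : f.adjoint ∘ₗ f = Matrix.toLpLin 2 2 (Zᵀ * Z) := by
    rw [← hMM, Matrix.toLpLin_mul 2 2 2]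
    congr 1
    have := Matrix.toEuclideanLin_conjTranspose_eq_adjoint M
    rw [Matrix.conjTranspose_eq_transpose_of_trivial] at this
    exact this.symm
  have hpos : 0 < σ := f.singularValues_pos_iff_lt_finrank_range.mpr (by omega)
  refine ⟨hpos, ?_⟩
  have hH : W.IsHermitian := hWp.isHermitian
  have hsa : IsSelfAdjoint W := hH
  have hc : ∀ g : ℝ → ℝ, ContinuousOn g (spectrum ℝ W) := fun g =>
    (Matrix.finite_real_spectrum (A := W)).continuousOn g
  have hcfc : W - σ ^ 2 • (1 : Matrix (Fin p) (Fin p) ℝ) = cfc (fun x : ℝ => x - σ ^ 2) W := by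
    rw [cfc_sub _ _ W (hc _) (hc _), cfc_id' ℝ W, cfc_const _ W, Algebra.algebraMap_eq_smul_one]
  rw [hcfc]
  refine Matrix.PosSemidef.cfc_of_nonneg W _ fun x hx => sub_nonneg.mpr ?_
  rw [hH.spectrum_real_eq_range_eigenvalues] at hx
  obtain ⟨i, rfl⟩ := hx
  set w := hH.eigenvalues i with hw
  have hwp : 0 < w := hWp.eigenvalues_pos i
  set v : Fin p → ℝ := (hH.eigenvectorBasis i).ofLp with hv
  have hvW : W *ᵥ v = w • v := hH.mulVec_eigenvectorBasis i
  have hv0 : v ≠ 0 := by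
    intro h
    have := hH.eigenvectorBasis.orthonormal.ne_zero i
    exact this (by ext j; exact congrFun h j)
  -- If `v` is an eigenvector of `Z Zᵀ`, then `Zᵀ v` is an eigenvector of `Zᵀ Z = Mᵀ M` for the same
  -- eigenvalue, which is thus a squared singular value of `M`.
  have hev : Module.End.HasEigenvalue (f.adjoint ∘ₗ f) w := by
    refine Module.End.hasEigenvalue_of_hasEigenvector (x := WithLp.toLp 2 (Zᵀ *ᵥ v)) ⟨?_, ?_⟩
    · rw [Module.End.mem_eigenspace_iff, hadj, Matrix.toLpLin_toLp, Matrix.toLin'_apply,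
        ← WithLp.toLp_smul, ← Matrix.mulVec_mulVec, Matrix.mulVec_mulVec (M := Z), ← hW, hvW,
        Matrix.mulVec_smul]
    · intro h
      have h1 : Zᵀ *ᵥ v = 0 := congrArg WithLp.ofLp h
      have h2 : W *ᵥ v = 0 := by rw [hW, ← Matrix.mulVec_mulVec, h1, Matrix.mulVec_zero]
      rw [hvW] at h2
      exact (smul_ne_zero hwp.ne' hv0) h2
  obtain ⟨j, hj⟩ := f.isSymmetric_adjoint_comp_self.exists_eigenvalues_eq rfl hev
  have hj2 : f.singularValues j ^ 2 = w := by
    rw [f.sq_singularValues_fin rfl]; exact hj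
  -- The eigenvalue is positive and `M` has rank `p`, so its zero-based index is below `p`;
  -- monotonicity then compares it with the last nonzero singular value, at index `p - 1`.
  have hjp : (j : ℕ) < p := by
    rw [← hfr, ← f.singularValues_pos_iff_lt_finrank_range]
    refine lt_of_le_of_ne (f.singularValues_nonneg _) fun h => ?_
    rw [← h] at hj2
    norm_num at hj2
    exact hwp.ne hj2
  rw [← hj2]
  exact pow_le_pow_left₀ hpos.le (f.singularValues_antitone (by omega)) 2


/-- Multi-indices `(s₁, …, s_k)`. -/
abbrev Prefix {N : ℕ} (d : Fin N → ℕ) (k : ℕ) : Type :=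
  (i : {i : Fin N // (i : ℕ) < k}) → Fin (d i)

/-- Multi-indices `(s_{k+1}, …, s_N)`. -/
abbrev Suffix {N : ℕ} (d : Fin N → ℕ) (k : ℕ) : Type :=
  (i : {i : Fin N // ¬ (i : ℕ) < k}) → Fin (d i)

/-! ### Interface matrices, Gram recursion and norm bounds -/

section Interface

variable {N : ℕ} {d : Fin N → ℕ} {r : Bonds N}

/-- Append the index `s_{k+1}` to `(s₁, …, s_k)`. -/
def Prefix.snoc {k : ℕ} (h : k < N) (u : Prefix d k) (s : Fin (d ⟨k, h⟩)) : Prefix d (k + 1) :=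
  fun i => if hi : (i.1 : ℕ) < k then u ⟨i.1, hi⟩ else
    Fin.cast (congrArg d (Fin.ext (by have := i.2; simp only; omega))) s

/-- Splitting off the last index of a prefix. -/
def Prefix.snocEquiv {k : ℕ} (h : k < N) :
    Fin (d ⟨k, h⟩) × Prefix d k ≃ Prefix d (k + 1) where
  toFun p := p.2.snoc h p.1
  invFun u := (u ⟨⟨k, h⟩, Nat.lt_succ_self k⟩, fun i => u ⟨i.1, Nat.lt_succ_of_lt i.2⟩)
  left_inv p := by
    refine Prod.ext ?_ ?_
    · simp [Prefix.snoc]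
    · funext i
      simp [Prefix.snoc, i.2]
  right_inv u := by
    funext ⟨i, hi⟩
    by_cases h' : (i : ℕ) < k
    · simp [Prefix.snoc, h']
    · obtain rfl : i = ⟨k, h⟩ := Fin.ext (by simp only; omega)
      simp [Prefix.snoc]

/-- The left interface matrix `X^{≤k}`, with rows `X₁(s₁) ⋯ X_k(s_k)`. -/
def interface (X : Factors d r) : (k : ℕ) → k ≤ N → Matrix (Prefix d k) (Fin (r.dim k)) ℝ
  | 0, _ => Matrix.of fun _ _ => 1
  | k + 1, h => Matrix.of fun u b =>
      ((fun a => interface X k (Nat.le_of_succ_le h) (fun i => u ⟨i.1, Nat.lt_succ_of_lt i.2⟩) a) ᵥ*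
        X ⟨k, h⟩ (u ⟨⟨k, h⟩, Nat.lt_succ_self k⟩)) b

theorem leftProd_eq_interface (X : Factors d r) (s : (i : Fin N) → Fin (d i)) (k : ℕ) (h : k ≤ N)
    (a : Fin (r.dim 0)) (b : Fin (r.dim k)) :
    leftProd X s k h a b = interface X k h (fun i => s i) b := by
  induction k with
  | zero =>
    have : Subsingleton (Fin (r.dim 0)) := by rw [r.first]; infer_instance
    rw [Subsingleton.elim b a]
    simp [leftProd, interface]
  | succ k ih =>
    simp only [leftProd, interface, Matrix.mul_apply, Matrix.of_apply, Matrix.vecMul, dotProduct, ih]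

theorem interface_snoc (X : Factors d r) {k : ℕ} (h : k < N) (u : Prefix d k)
    (s : Fin (d ⟨k, h⟩)) :
    interface X (k + 1) h (u.snoc h s) = interface X k h.le u ᵥ* X ⟨k, h⟩ s := by
  funext b
  have e : (Prefix.snocEquiv h).symm (u.snoc h s) = (s, u) :=
    (Prefix.snocEquiv (d := d) h).symm_apply_apply (s, u)
  have e1 := congrArg Prod.fst e
  have e2 := congrArg Prod.snd e
  simp only [Prefix.snocEquiv, Equiv.coe_fn_symm_mk] at e1 e2
  simp only [interface, Matrix.of_apply, e1]
  rw [show (fun i : {i : Fin N // (i : ℕ) < k} =>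
    u.snoc h s ⟨i.1, Nat.lt_succ_of_lt i.2⟩) = u from e2]

/-- The Gram matrix of the left interfaces of two families of factors. -/
def gram (X Y : Factors d r) (k : ℕ) (h : k ≤ N) : Matrix (Fin (r.dim k)) (Fin (r.dim k)) ℝ :=
  (interface X k h)ᵀ * interface Y k h

theorem gram_apply (X Y : Factors d r) (k : ℕ) (h : k ≤ N) (a b) :
    gram X Y k h a b = ∑ u, interface X k h u a * interface Y k h u b := rfl

theorem gram_zero (X Y : Factors d r) : gram X Y 0 (Nat.zero_le N) = 1 := by
  have : Subsingleton (Fin (r.dim 0)) := by rw [r.first]; infer_instance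
  have : IsEmpty {i : Fin N // (i : ℕ) < 0} := ⟨fun i => Nat.not_lt_zero _ i.2⟩
  have : Unique (Prefix d 0) := Pi.uniqueOfIsEmpty _
  ext a b
  rw [Subsingleton.elim b a, gram_apply]
  simp [interface]

/-- Summing over the last index of the prefix propagates Gram matrices from bond to bond.
Left-orthogonality, tensor inner products and rotations are all handled through this recursion. -/
theorem gram_succ (X Y : Factors d r) {k : ℕ} (h : k < N) :
    gram X Y (k + 1) h = ∑ s, (X ⟨k, h⟩ s)ᵀ * gram X Y k h.le * Y ⟨k, h⟩ s := by
  ext a b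
  rw [gram_apply, ← (Prefix.snocEquiv h).sum_comp, Fintype.sum_prod_type, Matrix.sum_apply]
  refine Finset.sum_congr rfl fun s _ => ?_
  have : (X ⟨k, h⟩ s)ᵀ * gram X Y k h.le * Y ⟨k, h⟩ s =
      (interface X k h.le * X ⟨k, h⟩ s)ᵀ * (interface Y k h.le * Y ⟨k, h⟩ s) := by
    rw [gram, Matrix.transpose_mul, Matrix.mul_assoc, Matrix.mul_assoc, Matrix.mul_assoc]
  rw [this, Matrix.mul_apply]
  refine Finset.sum_congr rfl fun u _ => ?_
  have e : ∀ Z : Factors d r, interface Z (k + 1) h (Prefix.snocEquiv h (s, u)) =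
      interface Z k h.le u ᵥ* Z ⟨k, h⟩ s := fun Z => interface_snoc Z h u s
  simp only [e, Matrix.transpose_apply]
  rfl

theorem leftUnf_transpose_mul {a b c : ℕ} (V W : Fin b → Matrix (Fin a) (Fin c) ℝ) :
    (leftUnf V)ᵀ * leftUnf W = ∑ s, (V s)ᵀ * W s := by
  ext p q
  simp only [Matrix.mul_apply, Matrix.sum_apply, Matrix.transpose_apply, leftUnf, Matrix.of_apply,
    Fintype.sum_prod_type]

theorem gram_self_of_leftOrthogonal {X : Factors d r} (hX : IsLeftOrthogonal X) {k : ℕ}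
    (h : k < N) : gram X X k h.le = 1 := by
  induction k with
  | zero => exact gram_zero X X
  | succ k ih =>
    rw [gram_succ X X (Nat.lt_of_succ_lt h), ih (Nat.lt_of_succ_lt h)]
    simp only [Matrix.mul_one]
    rw [← leftUnf_transpose_mul]
    exact hX ⟨k, Nat.lt_of_succ_lt h⟩ h

/-- Tensor indices as prefixes of full length. -/
def Prefix.fullEquiv (d : Fin N → ℕ) : ((i : Fin N) → Fin (d i)) ≃ Prefix d N where
  toFun s i := s i
  invFun u i := u ⟨i, i.2⟩
  left_inv _ := rfl
  right_inv _ := rfl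

theorem toTensor_apply (X : Factors d r) (s : (i : Fin N) → Fin (d i)) (b : Fin (r.dim N)) :
    toTensor X s = interface X N le_rfl (fun i => s i) b := by
  have : Subsingleton (Fin (r.dim N)) := by rw [r.last]; infer_instance
  rw [Subsingleton.elim b ⟨0, by simp [r.last]⟩]
  exact leftProd_eq_interface X s N le_rfl _ _

theorem inner_toTensor (X Y : Factors d r) :
    inner ℝ (toTensor X) (toTensor Y) = (gram X Y N le_rfl).trace := by
  have : Subsingleton (Fin (r.dim N)) := by rw [r.last]; infer_instance
  have b : Fin (r.dim N) := ⟨0, by simp [r.last]⟩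
  rw [Matrix.trace, Fintype.sum_subsingleton _ b, Matrix.diag, gram_apply,
    ← (Prefix.fullEquiv d).sum_comp]
  simp only [PiLp.inner_apply, toTensor_apply _ _ b]
  refine Finset.sum_congr rfl fun s _ => ?_
  simp [Prefix.fullEquiv, mul_comm]

theorem norm_toTensor_sq (X : Factors d r) : ‖toTensor X‖ ^ 2 = (gram X X N le_rfl).trace := by
  rw [← inner_toTensor, real_inner_self_eq_norm_sq]

/-- The recursion multiplies the quadratic form of the Gram matrix by at most the squared operator
norm of each left unfolding. -/
theorem interface_mulVec_le (F : Factors d r) (c : Fin N → ℝ) (hc : ∀ i, 0 ≤ c i)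
    (hF : ∀ i x, (leftUnf (F i) *ᵥ x) ⬝ᵥ (leftUnf (F i) *ᵥ x) ≤ c i * (x ⬝ᵥ x)) (k : ℕ) (h : k ≤ N)
    (x : Fin (r.dim k) → ℝ) :
    x ⬝ᵥ (gram F F k h *ᵥ x) ≤ (∏ i : Fin k, c (Fin.castLE h i)) * (x ⬝ᵥ x) := by
  induction k with
  | zero => simp [gram_zero]
  | succ k ih =>
    rw [gram_succ F F h, Fin.prod_univ_castSucc, Matrix.sum_mulVec, dotProduct_sum]
    have e : ∀ s, x ⬝ᵥ (((F ⟨k, h⟩ s)ᵀ * gram F F k (Nat.le_of_succ_le h) * F ⟨k, h⟩ s) *ᵥ x) =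
        (F ⟨k, h⟩ s *ᵥ x) ⬝ᵥ (gram F F k (Nat.le_of_succ_le h) *ᵥ (F ⟨k, h⟩ s *ᵥ x)) := fun s => by
      rw [← Matrix.mulVec_mulVec, ← Matrix.mulVec_mulVec, Matrix.dotProduct_mulVec,
        Matrix.vecMul_transpose]
    have e2 : ∑ s, (F ⟨k, h⟩ s *ᵥ x) ⬝ᵥ (F ⟨k, h⟩ s *ᵥ x) =
        (leftUnf (F ⟨k, h⟩) *ᵥ x) ⬝ᵥ (leftUnf (F ⟨k, h⟩) *ᵥ x) := by
      simp only [dotProduct, Fintype.sum_prod_type]; rfl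
    have hp : 0 ≤ ∏ i : Fin k, c (Fin.castLE (Nat.le_of_succ_le h) i) :=
      Finset.prod_nonneg fun i _ => hc _
    calc _ ≤ ∑ s, (∏ i : Fin k, c (Fin.castLE (Nat.le_of_succ_le h) i)) *
          ((F ⟨k, h⟩ s *ᵥ x) ⬝ᵥ (F ⟨k, h⟩ s *ᵥ x)) := by
          refine Finset.sum_le_sum fun s _ => ?_
          rw [e]; exact ih _ _
      _ ≤ (∏ i : Fin k, c (Fin.castLE (Nat.le_of_succ_le h) i)) * (c ⟨k, h⟩ * (x ⬝ᵥ x)) := by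
          rw [← Finset.mul_sum, e2]
          exact mul_le_mul_of_nonneg_left (hF ⟨k, h⟩ x) hp
      _ = _ := by rw [mul_assoc]; rfl

/-- The Frobenius norm of a tensor train is at most the product of the operator norms of the left
unfoldings of its factors. -/
theorem norm_toTensor_sq_le_prod (F : Factors d r) (c : Fin N → ℝ) (hc : ∀ i, 0 ≤ c i)
    (hF : ∀ i x, (leftUnf (F i) *ᵥ x) ⬝ᵥ (leftUnf (F i) *ᵥ x) ≤ c i * (x ⬝ᵥ x)) :
    ‖toTensor F‖ ^ 2 ≤ ∏ i, c i := by
  have : Subsingleton (Fin (r.dim N)) := by rw [r.last]; infer_instance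
  have b : Fin (r.dim N) := ⟨0, by simp [r.last]⟩
  have h := interface_mulVec_le F c hc hF N le_rfl (fun _ => 1)
  simp only [dotProduct, Matrix.mulVec, Fintype.sum_subsingleton _ b, mul_one, one_mul] at h
  rw [norm_toTensor_sq, Matrix.trace, Fintype.sum_subsingleton _ b]
  exact h

theorem mulVec_dotProduct_self_le {m n : Type} [Fintype m] [Fintype n] (M : Matrix m n ℝ)
    (x : n → ℝ) : (M *ᵥ x) ⬝ᵥ (M *ᵥ x) ≤ frobSq M * (x ⬝ᵥ x) := by
  simp only [dotProduct, Matrix.mulVec, frobSq, Finset.sum_mul]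
  refine Finset.sum_le_sum fun a _ => ?_
  have := Finset.sum_mul_sq_le_sq_mul_sq Finset.univ (M a) x
  simpa only [sq, Finset.sum_mul] using this

theorem mulVec_dotProduct_self_of_orthonormal {m n : Type} [Fintype m] [Fintype n] [DecidableEq n]
    (M : Matrix m n ℝ) (hM : Mᵀ * M = 1) (x : n → ℝ) : (M *ᵥ x) ⬝ᵥ (M *ᵥ x) = x ⬝ᵥ x := by
  rw [Matrix.dotProduct_mulVec, Matrix.vecMul_mulVec, hM, Matrix.vecMul_one]

end Interface

/-! ### Multilinearity, telescoping expansions and the gradient -/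

section Multilinear

variable {N : ℕ} {d : Fin N → ℕ} {r : Bonds N}

theorem leftProd_congr {X Y : Factors d r} (s : (i : Fin N) → Fin (d i)) (k : ℕ) (h : k ≤ N)
    (hXY : ∀ i : Fin N, (i : ℕ) < k → X i = Y i) : leftProd X s k h = leftProd Y s k h := by
  induction k with
  | zero => rfl
  | succ k ih =>
    simp only [leftProd]
    rw [ih _ fun i hi => hXY i (Nat.lt_succ_of_lt hi), hXY ⟨k, h⟩ (Nat.lt_succ_self k)]

theorem leftProd_update_add_smul (X : Factors d r) (i : Fin N) (V W) (c : ℝ)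
    (s : (i : Fin N) → Fin (d i)) (k : ℕ) (h : k ≤ N) (hi : (i : ℕ) < k) :
    leftProd (Function.update X i (V + c • W)) s k h =
      leftProd (Function.update X i V) s k h + c • leftProd (Function.update X i W) s k h := by
  induction k with
  | zero => omega
  | succ k ih =>
    simp only [leftProd]
    rcases Nat.lt_succ_iff_lt_or_eq.mp hi with hk | hk
    · have hne : (⟨k, h⟩ : Fin N) ≠ i := fun e => by rw [← e] at hk; simp at hk
      rw [ih _ hk, Function.update_of_ne hne, Function.update_of_ne hne, Function.update_of_ne hne,
        Matrix.add_mul, Matrix.smul_mul]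
    · obtain rfl : i = ⟨k, h⟩ := Fin.ext hk
      have hc : ∀ V, leftProd (Function.update X ⟨k, h⟩ V) s k (Nat.le_of_succ_le h) =
          leftProd X s k (Nat.le_of_succ_le h) := fun V => leftProd_congr s k _ fun j hj =>
        Function.update_of_ne (fun e => by rw [e] at hj; simp at hj) _ _
      rw [hc, hc, hc, Function.update_self, Function.update_self, Function.update_self,
        Pi.add_apply, Pi.smul_apply, Matrix.mul_add, Matrix.mul_smul]

theorem toTensor_update_add_smul (X : Factors d r) (i : Fin N) (V W) (c : ℝ) :
    toTensor (Function.update X i (V + c • W)) =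
      toTensor (Function.update X i V) + c • toTensor (Function.update X i W) := by
  ext s
  simp only [toTensor, PiLp.add_apply, PiLp.smul_apply,
    leftProd_update_add_smul X i V W c s N le_rfl i.2, Matrix.add_apply, Matrix.smul_apply]

theorem toTensor_update_add (X : Factors d r) (i : Fin N) (V W) :
    toTensor (Function.update X i (V + W)) =
      toTensor (Function.update X i V) + toTensor (Function.update X i W) := by
  simpa using toTensor_update_add_smul X i V W 1

theorem toTensor_update_zero (X : Factors d r) (i : Fin N) :
    toTensor (Function.update X i 0) = 0 := by
  simpa using toTensor_update_add X i 0 0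

/-- The tensor train as a linear function of its `i`-th factor. -/
def slotMap (X : Factors d r) (i : Fin N) :
    (Fin (d i) → Matrix (Fin (r.dim i)) (Fin (r.dim (i + 1))) ℝ) →ₗ[ℝ] Tensor d where
  toFun V := toTensor (Function.update X i V)
  map_add' V W := toTensor_update_add X i V W
  map_smul' c V := by
    simpa [toTensor_update_zero] using toTensor_update_add_smul X i 0 V c

theorem slotMap_apply (X : Factors d r) (i : Fin N) (V) :
    slotMap X i V = toTensor (Function.update X i V) := rfl

/-- The first `n` factors of `B` followed by the remaining factors of `A`. -/
def splice (n : ℕ) (B A : Factors d r) : Factors d r :=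
  fun k => if (k : ℕ) < n then B k else A k

/-- The factors of `A` are replaced by those of `B` one at a time from the left; consecutive hybrids
differ in a single slot, and the sum telescopes. -/
theorem toTensor_sub_toTensor (A B : Factors d r) :
    toTensor A - toTensor B = ∑ j : Fin N, slotMap (splice j B A) j (A j - B j) := by
  have h0 : splice 0 B A = A := by funext k; simp [splice]
  have h1 : splice N B A = B := by funext k; simp [splice]
  have h2 : ∀ j : Fin N, slotMap (splice j B A) j (A j - B j) =
      toTensor (splice j B A) - toTensor (splice (j + 1) B A) := by
    intro j
    rw [map_sub]
    congr 1
    · rw [slotMap_apply, Function.update_eq_iff.mpr ⟨by simp [splice], fun _ _ => rfl⟩]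
    · rw [slotMap_apply]
      congr 1
      refine Function.update_eq_iff.mpr ⟨by simp [splice], fun k hk => ?_⟩
      have : (k : ℕ) ≠ j := fun e => hk (Fin.ext e)
      simp only [splice]
      by_cases h : (k : ℕ) < j
      · rw [if_pos h, if_pos (by omega)]
      · rw [if_neg h, if_neg (by omega)]
  simp only [h2]
  rw [Fin.sum_univ_eq_sum_range (fun n => toTensor (splice n B A) - toTensor (splice (n + 1) B A)) N,
    Finset.sum_range_sub', h0, h1]

/-- The first order part of a difference of tensor trains, up to second order terms. -/
theorem sum_slotMap_eq (X Y : Factors d r) :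
    ∑ i, slotMap X i (X i - Y i) = toTensor X - toTensor Y +
      ∑ i : Fin N, ∑ j : Fin N, if j < i then
        slotMap (splice j Y (Function.update X i (X i - Y i))) j (X j - Y j) else 0 := by
  rw [toTensor_sub_toTensor X Y, ← Finset.sum_add_distrib]
  refine Finset.sum_congr rfl fun i _ => ?_
  rw [← sub_eq_iff_eq_add']
  -- The telescoping sum has `Y` to the left of slot `i`, the derivative has `X` there. Their
  -- difference is telescoped again, and only slots `j < i` survive.
  rw [slotMap_apply, slotMap_apply, toTensor_sub_toTensor]
  refine Finset.sum_congr rfl fun j _ => ?_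
  rcases lt_trichotomy j i with h | rfl | h
  · rw [if_pos h, Function.update_of_ne h.ne, Function.update_of_ne h.ne]
    have e1 : splice i Y X j = Y j := by simp [splice, h]
    rw [e1, slotMap_apply, slotMap_apply]
    congr 2
    funext k
    simp only [splice]
    split_ifs with hk
    · rw [Function.update_of_ne (Fin.ne_of_lt (lt_trans (show k < j from hk) h))]
      simp [splice, lt_trans (show k < j from hk) h]
    · rfl
  · simp
  · rw [if_neg h.asymm, Function.update_of_ne h.ne', Function.update_of_ne h.ne']
    have e1 : splice i Y X j = X j := by simp [splice, not_lt.mpr h.le]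
    rw [e1, sub_self, map_zero]

theorem frobSq_eq_sum {a b c : ℕ} (V : Fin b → Matrix (Fin a) (Fin c) ℝ) :
    frobSq (leftUnf V) = ∑ s, frobSq (V s) := by
  simp only [frobSq, leftUnf, Matrix.of_apply, Fintype.sum_prod_type]

/-- The tensor train is affine along a direction supported in one slot, so the loss is a quadratic
polynomial on that line. -/
theorem lineDeriv_loss {m : ℕ} (A : Tensor d →ₗ[ℝ] EuclideanSpace ℝ (Fin m))
    (y : EuclideanSpace ℝ (Fin m)) (X : Factors d r) (i : Fin N) (V) :
    lineDeriv ℝ (loss A y) X (Pi.single i V : Factors d r) =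
      1 / (m : ℝ) * inner ℝ (A (toTensor X) - y) (A (slotMap X i V)) := by
  have e : ∀ t : ℝ, loss A y (X + t • (Pi.single i V : Factors d r)) =
      1 / (2 * (m : ℝ)) * (‖A (toTensor X) - y‖ ^ 2 +
        2 * (t * inner ℝ (A (toTensor X) - y) (A (slotMap X i V))) +
          t ^ 2 * ‖A (slotMap X i V)‖ ^ 2) := by
    intro t
    have h1 : X + t • (Pi.single i V : Factors d r) = Function.update X i (X i + t • V) := by
      funext k
      rcases eq_or_ne k i with rfl | hk
      · simp
      · simp [Function.update_of_ne hk, Pi.single_eq_of_ne hk]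
    have h2 : A (toTensor (X + t • (Pi.single i V : Factors d r))) - y =
        (A (toTensor X) - y) + t • A (slotMap X i V) := by
      rw [h1, toTensor_update_add_smul, Function.update_eq_self, map_add, map_smul, slotMap_apply]
      abel
    rw [loss, h2, norm_add_sq_real, inner_smul_right, norm_smul, mul_pow, Real.norm_eq_abs, sq_abs]
  rw [lineDeriv]
  simp only [e]
  set p := inner ℝ (A (toTensor X) - y) (A (slotMap X i V))
  have hd : HasDerivAt (fun t : ℝ => 1 / (2 * (m : ℝ)) * (‖A (toTensor X) - y‖ ^ 2 +
      2 * (t * p) + t ^ 2 * ‖A (slotMap X i V)‖ ^ 2)) (1 / (2 * (m : ℝ)) * (2 * p)) 0 := by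
    have h1 : HasDerivAt (fun t : ℝ => 2 * (t * p)) (2 * (1 * p)) 0 :=
      ((hasDerivAt_id (0 : ℝ)).mul_const p).const_mul 2
    have h2 : HasDerivAt (fun t : ℝ => t ^ 2 * ‖A (slotMap X i V)‖ ^ 2)
        ((2 : ℕ) * (0 : ℝ) ^ (2 - 1) * ‖A (slotMap X i V)‖ ^ 2) 0 :=
      (hasDerivAt_pow 2 (0 : ℝ)).mul_const _
    have h3 := ((h1.const_add (‖A (toTensor X) - y‖ ^ 2)).add h2).const_mul (1 / (2 * (m : ℝ)))
    convert! h3 using 1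
    norm_num
  rw [hd.deriv]
  -- No positivity of `m` is assumed; for `m = 0` both sides vanish because division by zero gives
  -- zero.
  rcases eq_or_ne (m : ℝ) 0 with h | h
  · simp [h]
  · field_simp

/-- Pairing of the gradient of the loss with a direction in the `i`-th factor. -/
theorem trace_gradient_mul {m : ℕ} (A : Tensor d →ₗ[ℝ] EuclideanSpace ℝ (Fin m))
    (y : EuclideanSpace ℝ (Fin m)) (X : Factors d r) (i : Fin N) (V) :
    ((leftUnf V)ᵀ * leftUnf (gradient (loss A y) X i)).trace =
      1 / (m : ℝ) * inner ℝ (A (toTensor X) - y) (A (slotMap X i V)) := by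
  set p : (Fin (d i) → Matrix (Fin (r.dim i)) (Fin (r.dim (i + 1))) ℝ) →ₗ[ℝ] ℝ :=
    (1 / (m : ℝ)) • ((innerₛₗ ℝ (A (toTensor X) - y)).comp (A.comp (slotMap X i))) with hp
  have hp' : ∀ V, p V = 1 / (m : ℝ) * inner ℝ (A (toTensor X) - y) (A (slotMap X i V)) :=
    fun V => rfl
  have hV : V = ∑ s, ∑ a, ∑ b, V s a b • Pi.single s (Matrix.single a b (1 : ℝ)) := by
    funext s
    rw [Finset.sum_apply]
    simp only [Finset.sum_apply, Pi.smul_apply]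
    rw [Finset.sum_eq_single s]
    · simp only [Pi.single_eq_same, Matrix.smul_single, smul_eq_mul, mul_one]
      exact Matrix.matrix_eq_sum_single (V s)
    · intro t _ ht
      simp [Pi.single_eq_of_ne ht.symm]
    · simp
  rw [← hp' V]
  conv_rhs => rw [hV]
  have hg : ∀ s a b, p (Pi.single s (Matrix.single a b (1 : ℝ))) =
      gradient (loss A y) X i s a b := fun s a b => by
    rw [hp', ← lineDeriv_loss]; rfl
  simp only [map_sum, map_smul, hg, smul_eq_mul]
  rw [leftUnf_transpose_mul, Matrix.trace_sum]
  refine Finset.sum_congr rfl fun s _ => ?_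
  simp only [Matrix.trace, Matrix.diag, Matrix.mul_apply, Matrix.transpose_apply]
  exact Finset.sum_comm

end Multilinear

/-! ### Angles between column spaces -/

section Subspaces

variable {m n p : Type} [Fintype m] [Fintype n] [Fintype p] [DecidableEq p]

theorem posSemidef_one_sub_gram (U V : Matrix m p ℝ) (hU : Uᵀ * U = 1) (hV : Vᵀ * V = 1) :
    (1 - (Uᵀ * V)ᵀ * (Uᵀ * V)).PosSemidef := by
  have e : 1 - (Uᵀ * V)ᵀ * (Uᵀ * V) = (V - U * (Uᵀ * V))ᵀ * (V - U * (Uᵀ * V)) := by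
    have h1 : (U * (Uᵀ * V))ᵀ * V = (Uᵀ * V)ᵀ * (Uᵀ * V) := by
      rw [Matrix.transpose_mul, Matrix.mul_assoc]
    have h2 : Vᵀ * (U * (Uᵀ * V)) = (Uᵀ * V)ᵀ * (Uᵀ * V) := by
      rw [Matrix.transpose_mul, Matrix.transpose_transpose, Matrix.mul_assoc]
    have h3 : (U * (Uᵀ * V))ᵀ * (U * (Uᵀ * V)) = (Uᵀ * V)ᵀ * (Uᵀ * V) := by
      rw [Matrix.transpose_mul, Matrix.mul_assoc, ← Matrix.mul_assoc Uᵀ U, hU, Matrix.one_mul]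
    rw [Matrix.transpose_sub, Matrix.sub_mul, Matrix.mul_sub, Matrix.mul_sub, h1, h2, h3, hV]
    abel
  rw [e]
  have := Matrix.posSemidef_conjTranspose_mul_self (V - U * (Uᵀ * V))
  rwa [Matrix.conjTranspose_eq_transpose_of_trivial] at this

/-- A sine-theta bound: the angles between the column spaces of `U Z` and `V W` are controlled by
the distance of the two matrices. -/
theorem sq_mul_trace_one_sub_gram_le (U V : Matrix m p ℝ) (Z W : Matrix p n ℝ)
    (hU : Uᵀ * U = 1) (hV : Vᵀ * V = 1) (σ : ℝ)
    (hW : (W * Wᵀ - σ ^ 2 • (1 : Matrix p p ℝ)).PosSemidef) :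
    σ ^ 2 * (1 - (Uᵀ * V)ᵀ * (Uᵀ * V)).trace ≤ frobSq (U * Z - V * W) := by
  set C := Uᵀ * V with hC
  -- By Pythagoras, `‖U Z - V W‖² = ‖Z - C W‖² + tr ((1 - Cᵀ C) W Wᵀ)`. The first term is dropped,
  -- and `W Wᵀ ≥ σ²` is used in the second.
  have h1 := (posSemidef_one_sub_gram U V hU hV).trace_mul_nonneg hW
  rw [← hC] at h1
  have h2 := frobSq_nonneg (Z - C * W)
  have e1 : frobSq (U * Z - V * W) =
      (Zᵀ * Z).trace - 2 * (Zᵀ * (C * W)).trace + (Wᵀ * W).trace := by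
    have a1 : (U * Z)ᵀ * (U * Z) = Zᵀ * Z := by
      rw [Matrix.transpose_mul, Matrix.mul_assoc, ← Matrix.mul_assoc Uᵀ U, hU, Matrix.one_mul]
    have a2 : (V * W)ᵀ * (V * W) = Wᵀ * W := by
      rw [Matrix.transpose_mul, Matrix.mul_assoc, ← Matrix.mul_assoc Vᵀ V, hV, Matrix.one_mul]
    have a3 : (U * Z)ᵀ * (V * W) = Zᵀ * (C * W) := by
      rw [Matrix.transpose_mul, Matrix.mul_assoc, ← Matrix.mul_assoc Uᵀ V]
    have a4 : ((V * W)ᵀ * (U * Z)).trace = (Zᵀ * (C * W)).trace := by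
      rw [← a3, ← Matrix.trace_transpose, Matrix.transpose_mul, Matrix.transpose_transpose]
    rw [frobSq_eq_trace, Matrix.transpose_sub, Matrix.sub_mul, Matrix.mul_sub, Matrix.mul_sub,
      Matrix.trace_sub, Matrix.trace_sub, Matrix.trace_sub, a1, a2, a3, a4]
    ring
  have e2 : frobSq (Z - C * W) =
      (Zᵀ * Z).trace - 2 * (Zᵀ * (C * W)).trace + (Cᵀ * C * (W * Wᵀ)).trace := by
    have a4 : ((C * W)ᵀ * Z).trace = (Zᵀ * (C * W)).trace := by
      rw [← Matrix.trace_transpose, Matrix.transpose_mul, Matrix.transpose_transpose]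
    have a5 : ((C * W)ᵀ * (C * W)).trace = (Cᵀ * C * (W * Wᵀ)).trace := by
      rw [Matrix.transpose_mul, Matrix.mul_assoc, Matrix.trace_mul_comm]
      simp only [Matrix.mul_assoc]
    rw [frobSq_eq_trace, Matrix.transpose_sub, Matrix.sub_mul, Matrix.mul_sub, Matrix.mul_sub,
      Matrix.trace_sub, Matrix.trace_sub, Matrix.trace_sub, a4, a5]
    ring
  have e3 : ((1 - Cᵀ * C) * (W * Wᵀ - σ ^ 2 • (1 : Matrix p p ℝ))).trace =
      (Wᵀ * W).trace - (Cᵀ * C * (W * Wᵀ)).trace - σ ^ 2 * (1 - Cᵀ * C).trace := by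
    rw [Matrix.mul_sub, Matrix.trace_sub, Matrix.sub_mul, Matrix.trace_sub, Matrix.one_mul,
      Matrix.mul_smul, Matrix.mul_one, Matrix.trace_smul, Matrix.trace_mul_comm W, smul_eq_mul]
  linarith

end Subspaces

/-! ### Rotations, ranks of differences and factorised unfoldings -/

section Structure

variable {N : ℕ} {d : Fin N → ℕ} {r : Bonds N}

theorem Rotations.transpose_mul_self (R : Rotations r) (k : ℕ) :
    (R.1 k).1ᵀ * (R.1 k).1 = 1 := (Matrix.mem_orthogonalGroup_iff' _ _).mp (R.1 k).2

theorem Rotations.mul_transpose_self (R : Rotations r) (k : ℕ) :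
    (R.1 k).1 * (R.1 k).1ᵀ = 1 := (Matrix.mem_orthogonalGroup_iff _ _).mp (R.1 k).2

theorem leftProd_rotate (R : Rotations r) (X : Factors d r) (s : (i : Fin N) → Fin (d i)) (k : ℕ)
    (h : k ≤ N) : leftProd (rotate R X) s k h = leftProd X s k h * (R.1 k).1 := by
  induction k with
  | zero => simp [leftProd, R.2.1]
  | succ k ih =>
    simp only [leftProd, ih, rotate]
    simp only [Matrix.mul_assoc]
    rw [← Matrix.mul_assoc (R.1 k).1, R.mul_transpose_self, Matrix.one_mul]

theorem toTensor_rotate (R : Rotations r) (X : Factors d r) :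
    toTensor (rotate R X) = toTensor X := by
  ext s
  simp only [toTensor, leftProd_rotate, R.2.2]
  simp

/-- Interior rotations cancel along the chain, so only the rotation at the current bond remains.
This is why each bond can be aligned separately. -/
theorem gram_rotate (R : Rotations r) (X Y : Factors d r) (k : ℕ) (h : k ≤ N) :
    gram (rotate R X) Y k h = (R.1 k).1ᵀ * gram X Y k h := by
  induction k with
  | zero => simp [gram_zero, R.2.1]
  | succ k ih =>
    rw [gram_succ _ _ h, gram_succ _ _ h, Matrix.mul_sum]
    refine Finset.sum_congr rfl fun s _ => ?_
    rw [ih]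
    simp only [rotate, Matrix.transpose_mul, Matrix.transpose_transpose, Matrix.mul_assoc]
    rw [← Matrix.mul_assoc (R.1 k).1, R.mul_transpose_self, Matrix.one_mul]

theorem isLeftOrthogonal_rotate (R : Rotations r) {X : Factors d r} (hX : IsLeftOrthogonal X) :
    IsLeftOrthogonal (rotate R X) := by
  intro i hi
  have h := hX i hi
  rw [leftUnf_transpose_mul] at h ⊢
  have e : ∀ s, (rotate R X i s)ᵀ * rotate R X i s =
      (R.1 (i + 1)).1ᵀ * ((X i s)ᵀ * X i s) * (R.1 (i + 1)).1 := fun s => by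
    simp only [rotate, Matrix.transpose_mul, Matrix.transpose_transpose, Matrix.mul_assoc]
    rw [← Matrix.mul_assoc (R.1 i).1, R.mul_transpose_self, Matrix.one_mul]
  simp only [e]
  rw [← Matrix.sum_mul, ← Matrix.mul_sum, h, Matrix.mul_one, R.transpose_mul_self]

theorem dim_le_maxRank (r : Bonds N) {k : ℕ} (h1 : 1 ≤ k) (h2 : k < N) : r.dim k ≤ r.maxRank :=
  Finset.le_sup (f := r.dim) (Finset.mem_Ico.mpr ⟨h1, h2⟩)

/-- The difference of two tensors in TT format is in TT format, with twice the ranks. -/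
theorem exists_toTensor_eq_sub (X Y : Factors d r) (hN : 0 < N) :
    ∃ ρ : Bonds N, (∀ k, 1 ≤ k → k < N → ρ.dim k ≤ 2 * r.maxRank) ∧
      ∃ Z : Factors d ρ, toTensor Z = toTensor X - toTensor Y := by
  -- Offset of the second diagonal block. It vanishes at the two ends, so the boundary dimensions
  -- stay equal to `1` and the two chains share one row at the start and one column at the end.
  set o : ℕ → ℕ := fun k => if 0 < k ∧ k < N then r.dim k else 0 with ho
  have o0 : o 0 = 0 := by simp [ho]
  have oN : o N = 0 := by simp [ho]
  let ρ : Bonds N := ⟨fun k => o k + r.dim k, by simp [o0, r.first], by simp [oN, r.last]⟩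
  let J : ∀ k, Matrix (Fin (ρ.dim k)) (Fin (r.dim k)) ℝ := fun k =>
    Matrix.of fun a b => if (a : ℕ) = b then 1 else 0
  let J' : ∀ k, Matrix (Fin (ρ.dim k)) (Fin (r.dim k)) ℝ := fun k =>
    Matrix.of fun a b => if (a : ℕ) = o k + b then 1 else 0
  have hlt : ∀ k, ∀ b : Fin (r.dim k), (b : ℕ) < ρ.dim k := fun k b =>
    lt_of_lt_of_le b.2 (Nat.le_add_left _ _)
  have hlt' : ∀ k, ∀ b : Fin (r.dim k), o k + (b : ℕ) < ρ.dim k := fun k b =>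
    Nat.add_lt_add_left b.2 _
  have hmul : ∀ (k : ℕ) (M : Matrix (Fin (ρ.dim k)) (Fin (r.dim k)) ℝ) (a b),
      ((J k)ᵀ * M) a b = M ⟨a, hlt k a⟩ b := fun k M a b => by
    rw [Matrix.mul_apply, Finset.sum_eq_single ⟨a, hlt k a⟩]
    · simp [J]
    · intro c _ hc
      have : (c : ℕ) ≠ a := fun e => hc (Fin.ext e)
      simp [J, this]
    · simp
  have hmul' : ∀ (k : ℕ) (M : Matrix (Fin (ρ.dim k)) (Fin (r.dim k)) ℝ) (a b),
      ((J' k)ᵀ * M) a b = M ⟨o k + a, hlt' k a⟩ b := fun k M a b => by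
    rw [Matrix.mul_apply, Finset.sum_eq_single ⟨o k + a, hlt' k a⟩]
    · simp [J']
    · intro c _ hc
      have : (c : ℕ) ≠ o k + a := fun e => hc (Fin.ext e)
      simp [J', this]
    · simp
  have hJJ : ∀ k, (J k)ᵀ * J k = 1 := fun k => by
    ext a b; rw [hmul]; simp [J, Matrix.one_apply, Fin.ext_iff]
  have hJJ' : ∀ k, (J' k)ᵀ * J' k = 1 := fun k => by
    ext a b; rw [hmul']; simp [J', Matrix.one_apply, Fin.ext_iff]
  have hx : ∀ k, 0 < k → k < N → (J k)ᵀ * J' k = 0 := fun k h0 h1 => by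
    ext a b; rw [hmul]
    have : o k = r.dim k := by simp [ho, h0, h1]
    have : (a : ℕ) ≠ o k + b := by have := a.2; omega
    simp [J', this]
  have hx' : ∀ k, 0 < k → k < N → (J' k)ᵀ * J k = 0 := fun k h0 h1 => by
    rw [← Matrix.transpose_transpose (J k), ← Matrix.transpose_mul, hx k h0 h1,
      Matrix.transpose_zero]
  have hend : ∀ k, o k = 0 → J' k = J k := fun k hk => by
    ext a b; simp [J, J', hk]
  -- The minus sign of the difference is put into the last factor only.
  let c : ℕ → ℝ := fun k => if k = N then -1 else 1
  let Z : Factors d ρ := fun i s =>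
    J i * X i s * (J (i + 1))ᵀ + c (i + 1) • (J' i * Y i s * (J' (i + 1))ᵀ)
  refine ⟨ρ, ?_, Z, ?_⟩
  · intro k h1 h2
    have : o k = r.dim k := by simp only [ho]; rw [if_pos ⟨by omega, h2⟩]
    have h3 := dim_le_maxRank r h1 h2
    change o k + r.dim k ≤ _
    omega
  · have key : ∀ (s : (i : Fin N) → Fin (d i)) (k : ℕ) (h : k + 1 ≤ N),
        leftProd Z s (k + 1) h = J 0 * (leftProd X s (k + 1) h * (J (k + 1))ᵀ) +
          c (k + 1) • (J 0 * (leftProd Y s (k + 1) h * (J' (k + 1))ᵀ)) := by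
      intro s k h
      induction k with
      | zero =>
        simp only [leftProd, Z, Matrix.one_mul, hend 0 o0, Matrix.mul_assoc]
      | succ k ih =>
        rw [leftProd, ih (Nat.le_of_succ_le h)]
        have hc : c (k + 1) = 1 := if_neg (by omega)
        have a1 := hJJ (k + 1)
        have a2 := hJJ' (k + 1)
        have a3 := hx (k + 1) (Nat.succ_pos k) h
        have a4 := hx' (k + 1) (Nat.succ_pos k) h
        have b1 : ∀ M : Matrix (Fin (r.dim (k + 1))) (Fin (ρ.dim (k + 1 + 1))) ℝ,
            (J (k + 1))ᵀ * (J (k + 1) * M) = M := fun M => by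
          rw [← Matrix.mul_assoc, a1, Matrix.one_mul]
        have b2 : ∀ M : Matrix (Fin (r.dim (k + 1))) (Fin (ρ.dim (k + 1 + 1))) ℝ,
            (J' (k + 1))ᵀ * (J' (k + 1) * M) = M := fun M => by
          rw [← Matrix.mul_assoc, a2, Matrix.one_mul]
        have b3 : ∀ M : Matrix (Fin (r.dim (k + 1))) (Fin (ρ.dim (k + 1 + 1))) ℝ,
            (J (k + 1))ᵀ * (J' (k + 1) * M) = 0 := fun M => by
          rw [← Matrix.mul_assoc, a3, Matrix.zero_mul]
        have b4 : ∀ M : Matrix (Fin (r.dim (k + 1))) (Fin (ρ.dim (k + 1 + 1))) ℝ,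
            (J' (k + 1))ᵀ * (J (k + 1) * M) = 0 := fun M => by
          rw [← Matrix.mul_assoc, a4, Matrix.zero_mul]
        simp only [Z, hc, one_smul, Matrix.add_mul, Matrix.mul_add, Matrix.mul_smul,
          Matrix.mul_assoc, b1, b2, b3, b4, Matrix.mul_zero, add_zero, zero_add]
        simp only [leftProd, Matrix.mul_assoc]
    ext s
    obtain ⟨n, rfl⟩ : ∃ n, N = n + 1 := ⟨N - 1, by omega⟩
    have : Subsingleton (Fin (r.dim 0)) := by rw [r.first]; infer_instance
    have : Subsingleton (Fin (r.dim (n + 1))) := by rw [r.last]; infer_instance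
    have hc : c (n + 1) = -1 := if_pos rfl
    have entry : ∀ M : Matrix (Fin (r.dim 0)) (Fin (r.dim (n + 1))) ℝ,
        (J 0 * (M * (J (n + 1))ᵀ)) ⟨0, by simp [ρ.first]⟩ ⟨0, by simp [ρ.last]⟩ =
          M ⟨0, by simp [r.first]⟩ ⟨0, by simp [r.last]⟩ := fun M => by
      rw [Matrix.mul_apply, Fintype.sum_subsingleton _ ⟨0, by simp [r.first]⟩, Matrix.mul_apply,
        Fintype.sum_subsingleton _ ⟨0, by simp [r.last]⟩]
      simp [J]
    simp only [toTensor, PiLp.sub_apply, key s n le_rfl, hend (n + 1) oN, hc, Matrix.add_apply,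
      Matrix.smul_apply, entry]
    simp [sub_eq_add_neg]

/-- Prepend the index `s_{k+1}` to `(s_{k+2}, …, s_N)`. -/
def Suffix.cons {k : ℕ} (h : k < N) (s : Fin (d ⟨k, h⟩)) (v : Suffix d (k + 1)) : Suffix d k :=
  fun i => if hi : (i.1 : ℕ) < k + 1 then
    Fin.cast (congrArg d (Fin.ext (by have := i.2; simp only; omega))) s else v ⟨i.1, hi⟩

/-- Drop the first index of a suffix. -/
def Suffix.tail {k : ℕ} (v : Suffix d k) : Suffix d (k + 1) :=
  fun i => v ⟨i.1, fun h => i.2 (Nat.lt_succ_of_lt h)⟩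

theorem Suffix.tail_cons {k : ℕ} (h : k < N) (s : Fin (d ⟨k, h⟩)) (v : Suffix d (k + 1)) :
    (Suffix.cons h s v).tail = v := by
  funext i
  simp [Suffix.tail, Suffix.cons, i.2]

theorem Suffix.cons_head {k : ℕ} (h : k < N) (s : Fin (d ⟨k, h⟩)) (v : Suffix d (k + 1)) :
    Suffix.cons h s v ⟨⟨k, h⟩, lt_irrefl k⟩ = s := by
  simp [Suffix.cons]

theorem eq_zero_of_vecMul_eq_zero {m n : Type} [Fintype m] [Fintype n] (M : Matrix m n ℝ)
    (hM : M.rank = Fintype.card m) (x : m → ℝ) (hx : x ᵥ* M = 0) : x = 0 := by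
  have h : LinearIndependent ℝ M.row := by
    rw [linearIndependent_iff_card_eq_finrank_span, ← hM, Matrix.rank_eq_finrank_span_row]
    rfl
  have h2 := Matrix.vecMul_injective_iff.mpr h
  exact h2 (by simpa using hx)

/-- The matrix `Z` is the right interface, built from the last bond backwards. Full row rank of the
right unfoldings makes `x ↦ x ᵥ* Z` injective, which provides the singular value gap. -/
theorem exists_suffix_factor (X : Factors d r) (k : ℕ) (h : k ≤ N) :
    ∃ Z : Matrix (Fin (r.dim k)) (Suffix d k) ℝ,
      (∀ s : (i : Fin N) → Fin (d i),
        toTensor X s = ∑ b, interface X k h (fun i => s i) b * Z b (fun i => s i)) ∧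
      (IsMinimal X → ∀ x, x ᵥ* Z = 0 → x = 0) := by
  induction h using Nat.decreasingInduction with
  | self =>
    have : Subsingleton (Fin (r.dim N)) := by rw [r.last]; infer_instance
    have b : Fin (r.dim N) := ⟨0, by simp [r.last]⟩
    refine ⟨fun _ _ => 1, fun s => ?_, fun _ x hx => ?_⟩
    · rw [Fintype.sum_subsingleton _ b, mul_one]
      exact toTensor_apply X s b
    · funext a
      have := congrFun hx fun i => absurd i.1.2 i.2
      simpa [Matrix.vecMul, dotProduct, Fintype.sum_subsingleton _ a] using this
  | of_succ k hk ih =>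
    obtain ⟨Z, hZ, hinj⟩ := ih
    refine ⟨fun a v => ∑ b, X ⟨k, hk⟩ (v ⟨⟨k, hk⟩, lt_irrefl k⟩) a b * Z b v.tail,
      fun s => ?_, fun hX x hx => ?_⟩
    · rw [hZ s]
      simp only [interface, Matrix.of_apply, Matrix.vecMul, dotProduct, Finset.sum_mul,
        Finset.mul_sum]
      rw [Finset.sum_comm]
      refine Finset.sum_congr rfl fun a _ => Finset.sum_congr rfl fun b _ => ?_
      rw [mul_assoc]
      rfl
    · refine eq_zero_of_vecMul_eq_zero (rightUnf (X ⟨k, hk⟩)) ?_ x ?_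
      · rw [(hX ⟨k, hk⟩).2, Fintype.card_fin]
      · have h1 : ∀ s, x ᵥ* X ⟨k, hk⟩ s = 0 := fun s => by
          refine hinj hX _ ?_
          funext v
          have h2 := congrFun hx (Suffix.cons hk s v)
          simp only [Matrix.vecMul, dotProduct, Suffix.tail_cons, Suffix.cons_head, Pi.zero_apply]
            at h2 ⊢
          rw [← h2]
          simp only [Finset.sum_mul, Finset.mul_sum]
          rw [Finset.sum_comm]
          simp only [mul_assoc]
        funext ⟨s, b⟩
        exact congrFun (h1 s) b

theorem unfolding_eq_mul (X : Factors d r) {k : ℕ} (h : k ≤ N)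
    (Z : Matrix (Fin (r.dim k)) (Suffix d k) ℝ)
    (hZ : ∀ s : (i : Fin N) → Fin (d i),
        toTensor X s = ∑ b, interface X k h (fun i => s i) b * Z b (fun i => s i)) :
    unfolding (toTensor X) k = interface X k h * Z := by
  ext u v
  simp only [unfolding, Matrix.of_apply, hZ, Matrix.mul_apply]
  refine Finset.sum_congr rfl fun b _ => ?_
  have e := (Equiv.piEquivPiSubtypeProd (fun i : Fin N => (i : ℕ) < k) fun i => Fin (d i)).apply_symm_apply (u, v)
  have e1 := congrArg Prod.fst e
  have e2 := congrArg Prod.snd e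
  congr 2

theorem frobSq_unfolding (T : Tensor d) (k : ℕ) : frobSq (unfolding T k) = ‖T‖ ^ 2 := by
  rw [EuclideanSpace.real_norm_sq_eq, frobSq, ← Fintype.sum_prod_type',
    ← (Equiv.piEquivPiSubtypeProd (fun i : Fin N => (i : ℕ) < k) fun i => Fin (d i)).symm.sum_comp]
  rfl

theorem dim_pos_of_isMinimal {X : Factors d r} (hX : IsMinimal X) (k : ℕ) (h : k ≤ N) :
    0 < r.dim k := by
  induction k with
  | zero => simp [r.first]
  | succ k ih =>
    rw [Nat.pos_iff_ne_zero]
    intro h0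
    have h1 : _ = r.dim k := (hX ⟨k, h⟩).2
    have h2 := Matrix.rank_le_card_width (rightUnf (X ⟨k, h⟩))
    have h3 := ih (Nat.le_of_succ_le h)
    have h4 : Fintype.card (Fin (d ⟨k, h⟩) × Fin (r.dim (k + 1))) = 0 := by simp [h0]
    rw [h1] at h2
    exact absurd (h2.trans h4.le) (by omega)

theorem sigmaMin_pos {X : Factors d r} (hN : 2 ≤ N) (hmin : IsMinimal X)
    (hX : IsLeftOrthogonal X) : 0 < sigmaMin r (toTensor X) := by
  have : Nonempty (Finset.Ico 1 N) := ⟨⟨1, Finset.mem_Ico.mpr ⟨le_rfl, hN⟩⟩⟩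
  obtain ⟨⟨k, hk⟩, he⟩ := exists_eq_ciInf_of_finite
    (f := fun k : Finset.Ico 1 N => singularValue (unfolding (toTensor X) (k : ℕ)) (r.dim k))
  rw [sigmaMin, ← he]
  have hk' := Finset.mem_Ico.mp hk
  obtain ⟨Z, hZ, hinj⟩ := exists_suffix_factor X k hk'.2.le
  simp only
  rw [unfolding_eq_mul X hk'.2.le Z hZ]
  exact (posSemidef_mul_transpose_sub_singularValue (dim_pos_of_isMinimal hmin k hk'.2.le) _ Z
    (gram_self_of_leftOrthogonal hX hk'.2) (hinj hmin)).1

theorem exists_suffix_factor_sigmaMin {X : Factors d r} (hN : 2 ≤ N) (hmin : IsMinimal X)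
    (hX : IsLeftOrthogonal X) {k : ℕ} (h1 : 1 ≤ k) (h2 : k < N) :
    ∃ Z : Matrix (Fin (r.dim k)) (Suffix d k) ℝ,
      unfolding (toTensor X) k = interface X k h2.le * Z ∧
      (Z * Zᵀ - sigmaMin r (toTensor X) ^ 2 • (1 : Matrix _ _ ℝ)).PosSemidef := by
  obtain ⟨Z, hZ, hinj⟩ := exists_suffix_factor X k h2.le
  refine ⟨Z, unfolding_eq_mul X h2.le Z hZ, ?_⟩
  have h3 := (posSemidef_mul_transpose_sub_singularValue (dim_pos_of_isMinimal hmin k h2.le) _ Z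
    (gram_self_of_leftOrthogonal hX h2) (hinj hmin)).2
  have hle : sigmaMin r (toTensor X) ≤
      singularValue (interface X k h2.le * Z) (r.dim k) := by
    rw [← unfolding_eq_mul X h2.le Z hZ]
    exact ciInf_le (f := fun k : Finset.Ico 1 N =>
      singularValue (unfolding (toTensor X) (k : ℕ)) (r.dim k)) (Set.finite_range _).bddBelow
      ⟨k, Finset.mem_Ico.mpr ⟨h1, h2⟩⟩
  have hsq := pow_le_pow_left₀ (sigmaMin_pos hN hmin hX).le hle 2
  have h4 := h3.add ((Matrix.PosSemidef.one (n := Fin (r.dim k)) (R := ℝ)).smul (sub_nonneg.mpr hsq))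
  convert! h4 using 1
  module

/-- For the first unfolding, `tr (Z Zᵀ)` is the squared norm of the tensor and dominates `r₁ σ²`,
with `r₁ ≥ 1`. -/
theorem sigmaMin_sq_le {X : Factors d r} (hN : 2 ≤ N) (hmin : IsMinimal X)
    (hX : IsLeftOrthogonal X) : sigmaMin r (toTensor X) ^ 2 ≤ ‖toTensor X‖ ^ 2 := by
  obtain ⟨Z, hZ, hp⟩ := exists_suffix_factor_sigmaMin hN hmin hX le_rfl (by omega : 1 < N)
  have h1 := hp.trace_nonneg
  have hd : (1 : ℝ) ≤ r.dim 1 := by exact_mod_cast dim_pos_of_isMinimal hmin 1 (by omega)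
  have h2 : (Z * Zᵀ).trace = ‖toTensor X‖ ^ 2 := by
    have hU : (interface X 1 (by omega))ᵀ * interface X 1 (by omega) = 1 :=
      gram_self_of_leftOrthogonal hX (by omega : 1 < N)
    rw [← frobSq_unfolding _ 1, hZ, frobSq_eq_trace, Matrix.transpose_mul, Matrix.mul_assoc,
      ← Matrix.mul_assoc _ _ Z, hU, Matrix.one_mul, Matrix.trace_mul_comm]
  rw [Matrix.trace_sub, h2, Matrix.trace_smul, Matrix.trace_one, Fintype.card_fin, smul_eq_mul] at h1
  nlinarith [sq_nonneg (sigmaMin r (toTensor X))]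

end Structure

/-! ### Close tensors have close factors -/

section Distance

theorem Rotations.nonempty {N : ℕ} (r : Bonds N) : Nonempty (Rotations r) := ⟨⟨fun _ => 1, rfl, rfl⟩⟩

theorem frobSq_sub {m n : Type} [Fintype m] [Fintype n] (A B : Matrix m n ℝ) :
    frobSq (A - B) = frobSq A + frobSq B - 2 * (Bᵀ * A).trace := by
  have h : (Aᵀ * B).trace = (Bᵀ * A).trace := by
    rw [← Matrix.trace_transpose, Matrix.transpose_mul, Matrix.transpose_transpose]
  simp only [frobSq_eq_trace, Matrix.transpose_sub, Matrix.sub_mul, Matrix.mul_sub,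
    Matrix.trace_sub, h]
  ring

/-- Writing `K = Sᵀ S`, this is `-2 ⟨SY, SX⟩ ≤ ‖SX‖² + ‖SY‖²`, with `tr K = ‖S‖²` in Frobenius norm.
-/
theorem neg_trace_mul_mul_le {b m n : Type} [Fintype b] [Fintype m] [Fintype n] {K : Matrix m m ℝ}
    (hK : K.PosSemidef) (X Y : b → Matrix m n ℝ) :
    -(2 * ∑ s, ((Y s)ᵀ * K * X s).trace) ≤
      K.trace * (∑ s, frobSq (X s) + ∑ s, frobSq (Y s)) := by
  obtain ⟨S, rfl⟩ := hK.exists_eq_transpose_mul_self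
  rw [← frobSq_eq_trace, Finset.mul_sum, ← Finset.sum_neg_distrib, ← Finset.sum_add_distrib,
    Finset.mul_sum]
  refine Finset.sum_le_sum fun s _ => ?_
  have h1 := frobSq_nonneg (S * X s - -(S * Y s))
  have e : (-(S * Y s))ᵀ * (S * X s) = -((Y s)ᵀ * (Sᵀ * S) * X s) := by
    simp only [Matrix.transpose_neg, Matrix.transpose_mul, Matrix.neg_mul, Matrix.mul_assoc]
  have e2 : frobSq (-(S * Y s)) = frobSq (S * Y s) := by simp [frobSq]
  rw [frobSq_sub, e, e2, Matrix.trace_neg] at h1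
  have h2 := frobSq_mul_le S (X s)
  have h3 := frobSq_mul_le S (Y s)
  linarith

theorem dotProduct_mulVec_le_trace {m : Type} [Fintype m] {K : Matrix m m ℝ}
    (hK : K.PosSemidef) (x : m → ℝ) : x ⬝ᵥ (K *ᵥ x) ≤ K.trace * (x ⬝ᵥ x) := by
  obtain ⟨S, rfl⟩ := hK.exists_eq_transpose_mul_self
  rw [← frobSq_eq_trace]
  convert! mulVec_dotProduct_self_le S x using 1
  rw [← Matrix.mulVec_mulVec, Matrix.dotProduct_mulVec, Matrix.vecMul_transpose]

/-- Orthogonal alignment of two matrices with orthonormal columns spanning nearby subspaces. -/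
theorem exists_orthogonal_alignment {m : Type} [Fintype m] {p : ℕ} (U V : Matrix m (Fin p) ℝ)
    (hU : Uᵀ * U = 1) (hV : Vᵀ * V = 1) (h : (1 - (Uᵀ * V)ᵀ * (Uᵀ * V)).trace < 1) :
    ∃ R : Matrix.orthogonalGroup (Fin p) ℝ, (1 - R.1ᵀ * (Uᵀ * V)).PosSemidef ∧
      (1 - R.1ᵀ * (Uᵀ * V)).trace ≤ (1 - (Uᵀ * V)ᵀ * (Uᵀ * V)).trace := by
  set C := Uᵀ * V with hC
  have hpsd := posSemidef_one_sub_gram U V hU hV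
  rw [← hC] at hpsd
  have hCC := Matrix.posSemidef_conjTranspose_mul_self C
  rw [Matrix.conjTranspose_eq_transpose_of_trivial] at hCC
  -- A positive semidefinite defect with trace below `1` has all eigenvalues below `1`, so `C` is
  -- invertible and its polar factor can serve as the rotation.
  have hpd : (Cᵀ * C).PosDef := by
    refine Matrix.PosDef.of_dotProduct_mulVec_pos hCC.isHermitian fun x hx => ?_
    have h1 := dotProduct_mulVec_le_trace hpsd x
    have hxx : 0 < x ⬝ᵥ x :=
      lt_of_le_of_ne (Finset.sum_nonneg fun i _ => mul_self_nonneg (x i))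
        (Ne.symm (mt dotProduct_self_eq_zero.mp hx))
    rw [Matrix.sub_mulVec, dotProduct_sub, Matrix.one_mulVec] at h1
    simp only [star_trivial]
    nlinarith
  obtain ⟨S, hS, hQS, hSS, hQQ, hQY, -⟩ := exists_retract_mul_eq C hpd
  refine ⟨⟨retract C, (Matrix.mem_orthogonalGroup_iff' _ _).mpr hQQ⟩, ?_⟩
  simp only [hQY]
  have hSt : Sᵀ = S := by
    simpa [Matrix.conjTranspose_eq_transpose_of_trivial] using hS.isHermitian.eq
  have hK : (1 - S).PosSemidef := by
    have e : 1 - S = (1 / 2 : ℝ) • ((U * retract C - V)ᵀ * (U * retract C - V)) := by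
      have e1 : (U * retract C)ᵀ * (U * retract C) = 1 := by
        rw [Matrix.transpose_mul, Matrix.mul_assoc, ← Matrix.mul_assoc Uᵀ, hU, Matrix.one_mul, hQQ]
      have e2 : (U * retract C)ᵀ * V = S := by
        rw [Matrix.transpose_mul, Matrix.mul_assoc, ← hC, hQY]
      have e3 : Vᵀ * (U * retract C) = S := by
        rw [← hSt, ← e2, Matrix.transpose_mul, Matrix.transpose_transpose]
      rw [Matrix.transpose_sub, Matrix.sub_mul, Matrix.mul_sub, Matrix.mul_sub, e1, e2, e3, hV]
      module
    rw [e]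
    have := Matrix.posSemidef_conjTranspose_mul_self (U * retract C - V)
    rw [Matrix.conjTranspose_eq_transpose_of_trivial] at this
    exact this.smul (by norm_num)
  refine ⟨hK, ?_⟩
  -- From `0 ≤ S ≤ 1` follows `tr S² ≤ tr S`, so the defect of `S` is at most that of `Cᵀ C = S²`.
  have h2 := hS.trace_mul_nonneg hK
  rw [Matrix.mul_sub, Matrix.mul_one, hSS, Matrix.trace_sub] at h2
  rw [Matrix.trace_sub, Matrix.trace_sub]
  linarith

variable {N : ℕ} {d : Fin N → ℕ} {r : Bonds N}

theorem trace_gram_last (X Y : Factors d r) (i : Fin N) (hi : (i : ℕ) + 1 = N) :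
    (gram X Y N le_rfl).trace = ∑ s, ((X i s)ᵀ * gram X Y i i.2.le * Y i s).trace := by
  obtain ⟨k, hk⟩ := i
  simp only at hi
  subst hi
  rw [gram_succ, Matrix.trace_sum]

theorem norm_toTensor_sq_eq_frobSq {X : Factors d r} (hX : IsLeftOrthogonal X) (i : Fin N)
    (hi : (i : ℕ) + 1 = N) : ‖toTensor X‖ ^ 2 = frobSq (leftUnf (X i)) := by
  rw [norm_toTensor_sq, trace_gram_last X X i hi, gram_self_of_leftOrthogonal hX i.2, frobSq_eq_sum]
  simp only [Matrix.mul_one, frobSq_eq_trace]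

theorem frobSq_leftUnf_of_leftOrthogonal {X : Factors d r} (hX : IsLeftOrthogonal X) (i : Fin N)
    (hi : (i : ℕ) + 1 < N) : frobSq (leftUnf (X i)) = r.dim (i + 1) := by
  rw [frobSq_eq_trace, hX i hi, Matrix.trace_one, Fintype.card_fin]

/-- The weighted squared distance of two families of factors, without rotations. -/
def costSq (X Y : Factors d r) : ℝ :=
  ∑ i : Fin N, (if (i : ℕ) + 1 < N then ‖toTensor Y‖ ^ 2 else 1) *
    frobSq (leftUnf (X i) - leftUnf (Y i))

theorem costSq_nonneg (X Y : Factors d r) : 0 ≤ costSq X Y :=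
  Finset.sum_nonneg fun i _ => mul_nonneg (by split_ifs <;> positivity) (frobSq_nonneg _)

theorem distSq_eq_iInf (X Y : Factors d r) : distSq X Y = ⨅ R : Rotations r, costSq X (rotate R Y) := by
  simp only [distSq, costSq, toTensor_rotate]

theorem distSq_le (X Y : Factors d r) (R : Rotations r) : distSq X Y ≤ costSq X (rotate R Y) := by
  rw [distSq_eq_iInf]
  exact ciInf_le ⟨0, by rintro _ ⟨R, rfl⟩; exact costSq_nonneg _ _⟩ R

/-- Bookkeeping for the reverse bound. The first factor carries no rank term because the Gram matrix
at bond `0` is trivial; the middle ones collect `r₂, …, r_{N-1}`. -/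
theorem sum_factor_bounds (hN : 2 ≤ N) :
    ∑ i : Fin N, (if (i : ℕ) + 1 < N then (2 + if 0 < (i : ℕ) then 2 * (r.dim (i + 1) : ℝ) else 0)
      else 17 / 4) = 2 * N + 9 / 4 + 2 * r.innerSum := by
  obtain ⟨n, rfl⟩ : ∃ n, N = n + 2 := ⟨N - 2, by omega⟩
  rw [Fin.sum_univ_eq_sum_range (fun i => if i + 1 < n + 2 then
    (2 + if 0 < i then 2 * (r.dim (i + 1) : ℝ) else 0) else 17 / 4), Finset.sum_range_succ,
    Finset.sum_range_succ']
  have e : ∑ k ∈ Finset.range n, (if k + 1 + 1 < n + 2 then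
      (2 + if 0 < k + 1 then 2 * (r.dim (k + 1 + 1) : ℝ) else 0) else 17 / 4) =
      2 * n + 2 * r.innerSum := by
    rw [Bonds.innerSum, Finset.sum_Ico_eq_sum_range, Nat.cast_sum, Finset.mul_sum,
      show n + 2 - 2 = n by omega]
    rw [show (2 : ℝ) * n = ∑ k ∈ Finset.range n, 2 by simp [mul_comm], ← Finset.sum_add_distrib]
    refine Finset.sum_congr rfl fun k hk => ?_
    have := Finset.mem_range.mp hk
    rw [if_pos (by omega), if_pos (by omega), show 2 + k = k + 1 + 1 by omega]
  rw [e]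
  simp
  ring

/-- The distance of left-orthogonal factors up to rotation is controlled by the distance of the
tensors. -/
theorem sq_mul_distSq_le (hN : 2 ≤ N) {X Y : Factors d r} (hX : IsLeftOrthogonal X)
    (hY : IsLeftOrthogonal Y) (hmin : IsMinimal Y)
    (hXn : ‖toTensor X‖ ^ 2 ≤ 9 / 4 * ‖toTensor Y‖ ^ 2)
    (hh : ‖toTensor X - toTensor Y‖ ^ 2 < sigmaMin r (toTensor Y) ^ 2) :
    sigmaMin r (toTensor Y) ^ 2 * distSq X Y ≤
      8 * ((N : ℝ) + 1 + r.innerSum) * ‖toTensor Y‖ ^ 2 * ‖toTensor X - toTensor Y‖ ^ 2 := by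
  set σ := sigmaMin r (toTensor Y) with hσ
  set η := ‖toTensor X - toTensor Y‖ ^ 2 with hη
  have hσ0 : 0 < σ := sigmaMin_pos hN hmin hY
  have hσs : σ ^ 2 ≤ ‖toTensor Y‖ ^ 2 := sigmaMin_sq_le hN hmin hY
  have hσ2 : 0 < σ ^ 2 := by positivity
  -- The unfoldings differ by exactly the tensor error, so the sine-theta bound applies at every
  -- interior bond.
  have htr : ∀ k, 1 ≤ k → ∀ h2 : k < N,
      σ ^ 2 * (1 - (gram Y X k h2.le)ᵀ * gram Y X k h2.le).trace ≤ η := by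
    intro k h1 h2
    obtain ⟨W, hW, hp⟩ := exists_suffix_factor_sigmaMin hN hmin hY h1 h2
    obtain ⟨Z, hZ, -⟩ := exists_suffix_factor X k h2.le
    have hZ' := unfolding_eq_mul X h2.le Z hZ
    have h := sq_mul_trace_one_sub_gram_le (interface X k h2.le) (interface Y k h2.le) Z W
      (gram_self_of_leftOrthogonal hX h2) (gram_self_of_leftOrthogonal hY h2) σ hp
    have e : unfolding (toTensor X - toTensor Y) k =
        unfolding (toTensor X) k - unfolding (toTensor Y) k := rfl
    rw [← hW, ← hZ', ← e, frobSq_unfolding] at h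
    convert! h using 2
    have e2 : (interface X k h2.le)ᵀ * interface Y k h2.le = (gram Y X k h2.le)ᵀ := by
      rw [gram, Matrix.transpose_mul, Matrix.transpose_transpose]
    rw [e2, Matrix.transpose_transpose, Matrix.trace_sub, Matrix.trace_sub, Matrix.trace_mul_comm]
  have hal : ∀ k, ∃ R : Matrix.orthogonalGroup (Fin (r.dim k)) ℝ, ((k = 0 ∨ k = N) → R = 1) ∧
      (1 ≤ k → ∀ h2 : k < N, (1 - R.1ᵀ * gram Y X k h2.le).PosSemidef ∧
        (1 - R.1ᵀ * gram Y X k h2.le).trace ≤ η / σ ^ 2) := by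
    intro k
    by_cases hk : 1 ≤ k ∧ k < N
    · obtain ⟨h1, h2⟩ := hk
      have h3 := htr k h1 h2
      have h4 : (1 - (gram Y X k h2.le)ᵀ * gram Y X k h2.le).trace ≤ η / σ ^ 2 := by
        rw [le_div_iff₀ hσ2]; linarith
      have h5 : η / σ ^ 2 < 1 := by rwa [div_lt_one hσ2]
      obtain ⟨R, hR1, hR2⟩ := exists_orthogonal_alignment (interface Y k h2.le)
        (interface X k h2.le) (gram_self_of_leftOrthogonal hY h2)
        (gram_self_of_leftOrthogonal hX h2) (h4.trans_lt h5)
      exact ⟨R, fun h => by omega, fun _ _ => ⟨hR1, hR2.trans h4⟩⟩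
    · exact ⟨1, fun _ => rfl, fun h1 h2 => absurd ⟨h1, h2⟩ hk⟩
  choose R hR1 hR2 using hal
  set Q : Rotations r := ⟨R, hR1 0 (Or.inl rfl), hR1 N (Or.inr rfl)⟩ with hQ
  set V := rotate Q Y with hV
  have hVo : IsLeftOrthogonal V := isLeftOrthogonal_rotate Q hY
  have hVT : toTensor V = toTensor Y := toTensor_rotate Q Y
  have hK : ∀ k, ∀ h2 : k < N, (1 - gram V X k h2.le).PosSemidef ∧
      (1 - gram V X k h2.le).trace ≤ if 0 < k then η / σ ^ 2 else 0 := by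
    intro k h2
    rcases Nat.eq_zero_or_pos k with rfl | h1
    · rw [gram_zero, sub_self]
      exact ⟨Matrix.PosSemidef.zero, by simp⟩
    · rw [if_pos h1, hV, gram_rotate]
      exact hR2 k h1 h2
  have hκ : 0 ≤ η / σ ^ 2 := by positivity
  -- Inserting `1 = G + (1 - G)`, with `G` the Gram matrix at the left bond, turns the main part
  -- into the trace of the next Gram matrix, which is known up to the defect; the rest is controlled
  -- by the trace of `1 - G`.
  have hcross : ∀ i : Fin N, ((leftUnf (V i))ᵀ * leftUnf (X i)).trace =
      ∑ s, ((V i s)ᵀ * gram V X i i.2.le * X i s).trace +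
        ∑ s, ((V i s)ᵀ * (1 - gram V X i i.2.le) * X i s).trace := by
    intro i
    rw [leftUnf_transpose_mul, Matrix.trace_sum, ← Finset.sum_add_distrib]
    refine Finset.sum_congr rfl fun s _ => ?_
    rw [← Matrix.trace_add, Matrix.mul_sub, Matrix.sub_mul, Matrix.mul_one]
    simp
  have hbound : ∀ i : Fin N, (if (i : ℕ) + 1 < N then ‖toTensor V‖ ^ 2 else 1) *
      frobSq (leftUnf (X i) - leftUnf (V i)) ≤ ‖toTensor Y‖ ^ 2 * (η / σ ^ 2) *
      (if (i : ℕ) + 1 < N then (2 + if 0 < (i : ℕ) then 2 * (r.dim (i + 1) : ℝ) else 0)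
      else 17 / 4) := by
    intro i
    have hKi := hK i i.2
    have hneg := neg_trace_mul_mul_le hKi.1 (X i) (V i)
    rw [← frobSq_eq_sum, ← frobSq_eq_sum] at hneg
    rw [frobSq_sub, hcross i]
    by_cases hi : (i : ℕ) + 1 < N
    · rw [if_pos hi, if_pos hi, hVT, mul_assoc]
      refine mul_le_mul_of_nonneg_left ?_ (sq_nonneg _)
      have h1 := (hK (i + 1) hi).2
      rw [if_pos (Nat.succ_pos _), gram_succ V X i.2, Matrix.trace_sub, Matrix.trace_one,
        Fintype.card_fin, Matrix.trace_sum] at h1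
      rw [frobSq_leftUnf_of_leftOrthogonal hX i hi, frobSq_leftUnf_of_leftOrthogonal hVo i hi]
        at hneg ⊢
      have h2 : (1 - gram V X i i.2.le).trace * ((r.dim (i + 1) : ℝ) + r.dim (i + 1)) ≤
          (if 0 < (i : ℕ) then η / σ ^ 2 else 0) * ((r.dim (i + 1) : ℝ) + r.dim (i + 1)) :=
        mul_le_mul_of_nonneg_right hKi.2 (by positivity)
      split_ifs at h2 ⊢ <;> nlinarith
    -- For the last factor the main part is the tensor inner product, giving `η`. The remainder is
    -- at most `9/4 + 1 = 13/4` times `‖toTensor Y‖² η / σ²`, whence `17/4`.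
    · have hi' : (i : ℕ) + 1 = N := by have := i.2; omega
      rw [if_neg hi, if_neg hi, one_mul]
      have h1 := inner_toTensor V X
      rw [trace_gram_last V X i hi'] at h1
      rw [← norm_toTensor_sq_eq_frobSq hX i hi', ← norm_toTensor_sq_eq_frobSq hVo i hi', hVT]
        at hneg ⊢
      rw [← h1, hVT]
      have h2 : η = ‖toTensor X‖ ^ 2 + ‖toTensor Y‖ ^ 2 -
          2 * inner ℝ (toTensor Y) (toTensor X) := by
        rw [hη, norm_sub_sq_real, real_inner_comm]; ring
      have h3 : (1 - gram V X i i.2.le).trace ≤ η / σ ^ 2 := by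
        refine hKi.2.trans ?_
        split_ifs <;> simp [hκ]
      have h4 : (1 - gram V X i i.2.le).trace * (‖toTensor X‖ ^ 2 + ‖toTensor Y‖ ^ 2) ≤
          η / σ ^ 2 * (13 / 4 * ‖toTensor Y‖ ^ 2) :=
        mul_le_mul h3 (by linarith) (by positivity) hκ
      have h5 : η = η / σ ^ 2 * σ ^ 2 := by field_simp
      have h6 : η / σ ^ 2 * σ ^ 2 ≤ η / σ ^ 2 * ‖toTensor Y‖ ^ 2 :=
        mul_le_mul_of_nonneg_left hσs hκ
      linarith
  have hcost : costSq X V ≤ ‖toTensor Y‖ ^ 2 * (η / σ ^ 2) *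
      (2 * N + 9 / 4 + 2 * r.innerSum) := by
    rw [← sum_factor_bounds hN, Finset.mul_sum]
    exact Finset.sum_le_sum fun i _ => hbound i
  have hN' : (2 : ℝ) ≤ N := by exact_mod_cast hN
  have hS : (0 : ℝ) ≤ r.innerSum := Nat.cast_nonneg _
  calc σ ^ 2 * distSq X Y ≤ σ ^ 2 * (‖toTensor Y‖ ^ 2 * (η / σ ^ 2) *
        (8 * ((N : ℝ) + 1 + r.innerSum))) := by
        refine mul_le_mul_of_nonneg_left ((distSq_le X Y Q).trans (hcost.trans ?_)) hσ2.le
        refine mul_le_mul_of_nonneg_left ?_ (by positivity)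
        linarith
    _ = _ := by field_simp

end Distance

/-! ### Existence of an optimal rotation -/

section Minimizer

theorem isCompact_orthogonalGroup (n : ℕ) :
    IsCompact (Matrix.orthogonalGroup (Fin n) ℝ : Set (Matrix (Fin n) (Fin n) ℝ)) := by
  have hK : IsCompact (Set.univ.pi fun _ : Fin n => Set.univ.pi fun _ : Fin n =>
      Set.Icc (-1 : ℝ) 1) := isCompact_univ_pi fun _ => isCompact_univ_pi fun _ => isCompact_Icc
  have hC : IsClosed (Matrix.orthogonalGroup (Fin n) ℝ : Set (Matrix (Fin n) (Fin n) ℝ)) := by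
    have : (Matrix.orthogonalGroup (Fin n) ℝ : Set (Matrix (Fin n) (Fin n) ℝ)) =
        {M | Mᵀ * M = 1} := by
      ext M; exact Matrix.mem_orthogonalGroup_iff' _ _
    rw [this]
    exact isClosed_eq (continuous_id.matrix_transpose.matrix_mul continuous_id) continuous_const
  refine IsCompact.of_isClosed_subset hK hC fun M hM a _ b _ => ?_
  have h0 : Mᵀ * M = 1 := (Matrix.mem_orthogonalGroup_iff' _ _).mp hM
  have h1 := congrFun (congrFun h0 b) b
  simp only [Matrix.mul_apply, Matrix.transpose_apply, Matrix.one_apply_eq] at h1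
  have h2 : M a b ^ 2 ≤ 1 := by
    rw [← h1, sq]
    exact Finset.single_le_sum (f := fun c => M c b * M c b)
      (fun c _ => mul_self_nonneg _) (Finset.mem_univ a)
  exact abs_le.mp ((sq_le_one_iff_abs_le_one _).mp h2)

variable {N : ℕ} {d : Fin N → ℕ} {r : Bonds N}

theorem continuous_costSq_rotate (X Y : Factors d r) :
    Continuous fun R : Rotations r => costSq X (rotate R Y) := by
  simp only [costSq, toTensor_rotate]
  refine continuous_finsetSum _ fun i _ => continuous_const.mul ?_
  have hk : ∀ k, Continuous fun R : Rotations r => (R.1 k).1 := fun k =>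
    continuous_subtype_val.comp ((continuous_apply k).comp continuous_subtype_val)
  have hr : ∀ s, Continuous fun R : Rotations r => rotate R Y i s := fun s =>
    ((hk i).matrix_transpose.matrix_mul continuous_const).matrix_mul (hk (i + 1))
  refine continuous_finsetSum _ fun p _ => continuous_finsetSum _ fun q _ => ?_
  exact (continuous_const.sub ((hr p.1).matrix_elem p.2 q)).pow 2

/-- The infimum in the definition of the distance is attained. -/
theorem exists_distSq_eq (X Y : Factors d r) :
    ∃ R : Rotations r, distSq X Y = costSq X (rotate R Y) := by
  have hG : ∀ k, CompactSpace (Matrix.orthogonalGroup (Fin (r.dim k)) ℝ) := fun k =>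
    isCompact_iff_compactSpace.mp (isCompact_orthogonalGroup _)
  have hC : IsClosed {R : (k : ℕ) → Matrix.orthogonalGroup (Fin (r.dim k)) ℝ |
      R 0 = 1 ∧ R N = 1} :=
    (isClosed_eq (continuous_apply 0) continuous_const).inter
      (isClosed_eq (continuous_apply N) continuous_const)
  have : CompactSpace (Rotations r) := isCompact_iff_compactSpace.mp hC.isCompact
  have := Rotations.nonempty r
  obtain ⟨R, -, hR⟩ := isCompact_univ.exists_isMinOn Set.univ_nonempty
    (continuous_costSq_rotate X Y).continuousOn
  refine ⟨R, le_antisymm (distSq_le X Y R) ?_⟩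
  rw [distSq_eq_iInf]
  exact le_ciInf fun R' => hR (Set.mem_univ R')

end Minimizer

/-! ### Norms of tensor trains with one or two perturbed factors -/

section NormBounds

variable {N : ℕ} {d : Fin N → ℕ} {r : Bonds N}

/-- The index of the last factor. -/
def lastIdx (hN : 0 < N) : Fin N := ⟨N - 1, Nat.sub_lt hN one_pos⟩

theorem eq_lastIdx (hN : 0 < N) (i : Fin N) : i = lastIdx hN ↔ ¬ (i : ℕ) + 1 < N := by
  rw [Fin.ext_iff, lastIdx]; have := i.2; simp only; omega

/-- Orthonormal left unfoldings have operator norm at most `1`, so only the inserted factor and,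
when distinct from it, the last factor contribute to the product bound. -/
theorem norm_slotMap_sq_le (hN : 0 < N) {F : Factors d r} (hF : IsLeftOrthogonal F) (i : Fin N)
    (V : Fin (d i) → Matrix (Fin (r.dim i)) (Fin (r.dim (i + 1))) ℝ) :
    ‖slotMap F i V‖ ^ 2 ≤ frobSq (leftUnf V) *
      if (i : ℕ) + 1 < N then frobSq (leftUnf (F (lastIdx hN))) else 1 := by
  set c : Fin N → ℝ := fun k => (if k = i then frobSq (leftUnf V) else 1) *
    if k = lastIdx hN then (if (i : ℕ) + 1 < N then frobSq (leftUnf (F (lastIdx hN))) else 1)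
      else 1 with hc
  have h := norm_toTensor_sq_le_prod (Function.update F i V) c
    (fun k => by
      have h1 := frobSq_nonneg (leftUnf V)
      have h2 := frobSq_nonneg (leftUnf (F (lastIdx hN)))
      refine mul_nonneg ?_ ?_ <;> split_ifs <;> first | assumption | norm_num)
    (fun k x => by
      simp only [hc]
      by_cases hk : k = i
      · subst hk
        rw [if_pos rfl, Function.update_self]
        have : (if k = lastIdx hN then (if (k : ℕ) + 1 < N then
            frobSq (leftUnf (F (lastIdx hN))) else 1) else 1) = (1 : ℝ) := by
          split_ifs with h1 h2
          · exact absurd h2 ((eq_lastIdx hN k).mp h1)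
          all_goals rfl
        rw [this, mul_one]
        exact mulVec_dotProduct_self_le _ x
      · rw [if_neg hk, one_mul, Function.update_of_ne hk]
        by_cases hl : k = lastIdx hN
        · subst hl
          have hi : (i : ℕ) + 1 < N := by
            by_contra h1
            exact hk ((eq_lastIdx hN i).mpr h1).symm
          rw [if_pos rfl, if_pos hi]
          exact mulVec_dotProduct_self_le _ x
        · rw [if_neg hl, one_mul]
          have h1 : (k : ℕ) + 1 < N := by
            by_contra h1; exact hl ((eq_lastIdx hN k).mpr h1)
          exact (mulVec_dotProduct_self_of_orthonormal _ (hF k h1) x).le)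
  rw [slotMap_apply]
  refine h.trans (le_of_eq ?_)
  simp only [hc, Finset.prod_mul_distrib, Finset.prod_ite_eq', Finset.mem_univ, if_true]

/-- Two-slot version, for the second-order terms. The smaller slot `j` is never the last, so the
last factor is either `V` itself or unchanged from `X`. -/
theorem norm_slotMap_splice_sq_le (hN : 0 < N) {X Y : Factors d r} (hX : IsLeftOrthogonal X)
    (hY : IsLeftOrthogonal Y) {i j : Fin N} (hij : j < i)
    (V : Fin (d i) → Matrix (Fin (r.dim i)) (Fin (r.dim (i + 1))) ℝ)
    (W : Fin (d j) → Matrix (Fin (r.dim j)) (Fin (r.dim (j + 1))) ℝ) :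
    ‖slotMap (splice j Y (Function.update X i V)) j W‖ ^ 2 ≤
      frobSq (leftUnf W) * (frobSq (leftUnf V) *
        if (i : ℕ) + 1 < N then frobSq (leftUnf (X (lastIdx hN))) else 1) := by
  set c : Fin N → ℝ := fun k => (if k = j then frobSq (leftUnf W) else 1) *
    ((if k = i then frobSq (leftUnf V) else 1) *
    if k = lastIdx hN then (if (i : ℕ) + 1 < N then frobSq (leftUnf (X (lastIdx hN))) else 1)
      else 1) with hc
  have hjl : (j : ℕ) + 1 < N := by have := i.2; have : (j : ℕ) < i := hij; omega
  have h := norm_toTensor_sq_le_prod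
    (Function.update (splice j Y (Function.update X i V)) j W) c
    (fun k => by
      have h0 := frobSq_nonneg (leftUnf W)
      have h1 := frobSq_nonneg (leftUnf V)
      have h2 := frobSq_nonneg (leftUnf (X (lastIdx hN)))
      refine mul_nonneg ?_ (mul_nonneg ?_ ?_) <;> split_ifs <;> first | assumption | norm_num)
    (fun k x => by
      simp only [hc]
      by_cases hkj : k = j
      · subst hkj
        have h1 : k ≠ lastIdx hN := fun e => (eq_lastIdx hN k).mp e hjl
        rw [if_pos rfl, Function.update_self, if_neg hij.ne, if_neg h1, mul_one, mul_one]
        exact mulVec_dotProduct_self_le _ x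
      rw [if_neg hkj, one_mul, Function.update_of_ne hkj]
      by_cases hk : k = i
      · subst hk
        have h1 : (if k = lastIdx hN then (if (k : ℕ) + 1 < N then
            frobSq (leftUnf (X (lastIdx hN))) else 1) else 1) = (1 : ℝ) := by
          split_ifs with h1 h2
          · exact absurd h2 ((eq_lastIdx hN k).mp h1)
          all_goals rfl
        have h2 : splice j Y (Function.update X k V) k = V := by
          rw [splice, if_neg (not_lt.mpr (show (j : ℕ) ≤ k from hij.le)), Function.update_self]
        rw [if_pos rfl, h1, mul_one, h2]
        exact mulVec_dotProduct_self_le _ x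
      · rw [if_neg hk, one_mul]
        by_cases hl : k = lastIdx hN
        · subst hl
          have hi : (i : ℕ) + 1 < N := by
            by_contra h1
            exact hk ((eq_lastIdx hN i).mpr h1).symm
          have h2 : splice j Y (Function.update X i V) (lastIdx hN) = X (lastIdx hN) := by
            rw [splice, if_neg (by simp only [lastIdx]; omega), Function.update_of_ne hk]
          rw [if_pos rfl, if_pos hi, h2]
          exact mulVec_dotProduct_self_le _ x
        · rw [if_neg hl, one_mul]
          have h1 : (k : ℕ) + 1 < N := by
            by_contra h1; exact hl ((eq_lastIdx hN k).mpr h1)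
          refine (mulVec_dotProduct_self_of_orthonormal _ ?_ x).le
          rw [splice]
          split_ifs
          · exact hY k h1
          · rw [Function.update_of_ne hk]; exact hX k h1)
  rw [slotMap_apply]
  refine h.trans (le_of_eq ?_)
  simp only [hc, Finset.prod_mul_distrib, Finset.prod_ite_eq', Finset.mem_univ, if_true]

theorem isLeftOrthogonal_splice {X Y : Factors d r} (hX : IsLeftOrthogonal X)
    (hY : IsLeftOrthogonal Y) (n : ℕ) : IsLeftOrthogonal (splice n Y X) := by
  intro i hi
  rw [splice]
  split_ifs
  exacts [hY i hi, hX i hi]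

end NormBounds

/-! ### Consequences of the restricted isometry property -/

section RIP

variable {N : ℕ} {d : Fin N → ℕ} {r : Bonds N} {m : ℕ}

/-- Plain Cauchy–Schwarz for the sensed inner product. It needs the upper isometry bound for `u` and
`v` separately, never for their sum. -/
theorem abs_inner_le_of_sq_le (A : Tensor d →ₗ[ℝ] EuclideanSpace ℝ (Fin m)) {δ : ℝ} (hδ : 0 ≤ 1 + δ)
    {u v : Tensor d} (hu : 1 / (m : ℝ) * ‖A u‖ ^ 2 ≤ (1 + δ) * ‖u‖ ^ 2)
    (hv : 1 / (m : ℝ) * ‖A v‖ ^ 2 ≤ (1 + δ) * ‖v‖ ^ 2) :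
    |1 / (m : ℝ) * inner ℝ (A u) (A v)| ≤ (1 + δ) * ‖u‖ * ‖v‖ := by
  have hm : 0 ≤ 1 / (m : ℝ) := by positivity
  rw [abs_mul, abs_of_nonneg hm]
  refine (mul_le_mul_of_nonneg_left (abs_real_inner_le_norm _ _) hm).trans ?_
  refine abs_le_of_sq_le_sq' ?_ (by positivity) |>.2
  calc (1 / (m : ℝ) * (‖A u‖ * ‖A v‖)) ^ 2 =
        (1 / (m : ℝ) * ‖A u‖ ^ 2) * (1 / (m : ℝ) * ‖A v‖ ^ 2) := by ring
    _ ≤ ((1 + δ) * ‖u‖ ^ 2) * ((1 + δ) * ‖v‖ ^ 2) :=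
        mul_le_mul hu hv (by positivity) (by positivity)
    _ = ((1 + δ) * ‖u‖ * ‖v‖) ^ 2 := by ring

theorem HasRIP.of_factors {A : Tensor d →ₗ[ℝ] EuclideanSpace ℝ (Fin m)} {δ : ℝ}
    (hA : HasRIP A ((N + 3) * r.maxRank) δ) (Z : Factors d r) :
    (1 - δ) * ‖toTensor Z‖ ^ 2 ≤ 1 / (m : ℝ) * ‖A (toTensor Z)‖ ^ 2 ∧
      1 / (m : ℝ) * ‖A (toTensor Z)‖ ^ 2 ≤ (1 + δ) * ‖toTensor Z‖ ^ 2 :=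
  hA r (fun k h1 h2 => (dim_le_maxRank r h1 h2).trans (Nat.le_mul_of_pos_left _ (by omega))) Z

theorem HasRIP.of_sub {A : Tensor d →ₗ[ℝ] EuclideanSpace ℝ (Fin m)} {δ : ℝ}
    (hA : HasRIP A ((N + 3) * r.maxRank) δ) (hN : 0 < N) (X Y : Factors d r) :
    (1 - δ) * ‖toTensor X - toTensor Y‖ ^ 2 ≤ 1 / (m : ℝ) * ‖A (toTensor X - toTensor Y)‖ ^ 2 ∧
      1 / (m : ℝ) * ‖A (toTensor X - toTensor Y)‖ ^ 2 ≤
        (1 + δ) * ‖toTensor X - toTensor Y‖ ^ 2 := by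
  obtain ⟨ρ, hρ, Z, hZ⟩ := exists_toTensor_eq_sub X Y hN
  rw [← hZ]
  exact hA ρ (fun k h1 h2 => (hρ k h1 h2).trans (Nat.mul_le_mul_right _ (by omega))) Z

end RIP

/-! ### Descent inequalities for the individual factors -/

section Descent

variable {N : ℕ} {d : Fin N → ℕ} {r : Bonds N} {m : ℕ}

/-- The bilinear form `⟨A u, A v⟩ / m`. -/
def sensing (A : Tensor d →ₗ[ℝ] EuclideanSpace ℝ (Fin m)) : Tensor d →ₗ[ℝ] Tensor d →ₗ[ℝ] ℝ :=
  (1 / (m : ℝ)) • (innerₗ (EuclideanSpace ℝ (Fin m))).compl₁₂ A A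

theorem sensing_apply (A : Tensor d →ₗ[ℝ] EuclideanSpace ℝ (Fin m)) (u v : Tensor d) :
    sensing A u v = 1 / (m : ℝ) * inner ℝ (A u) (A v) := rfl

/-- The slices of `L(V) K`. -/
theorem leftUnf_mul {a b c : ℕ} (V : Fin b → Matrix (Fin a) (Fin c) ℝ) (K : Matrix (Fin c) (Fin c) ℝ) :
    leftUnf (fun s => V s * K) = leftUnf V * K := rfl

/-- One step of Riemannian gradient descent in a factor other than the last one. -/
theorem frobSq_retract_step_le {X V X' : Factors d r} (hX : IsLeftOrthogonal X)
    (hV : IsLeftOrthogonal V) (A : Tensor d →ₗ[ℝ] EuclideanSpace ℝ (Fin m)) (T : Tensor d)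
    (c : ℝ) (i : Fin N) (hi : (i : ℕ) + 1 < N)
    (hX' : leftUnf (X' i) = retract (leftUnf (X i) -
      c • tangentProj (leftUnf (X i)) (leftUnf (gradient (loss A (A T)) X i)))) :
    (leftUnf (X' i))ᵀ * leftUnf (X' i) = 1 ∧
    frobSq (leftUnf (X' i) - leftUnf (V i)) ≤ frobSq (leftUnf (X i) - leftUnf (V i)) -
      2 * c * (sensing A (toTensor X - T) (slotMap X i (X i - V i)) -
        1 / 2 * sensing A (toTensor X - T) (slotMap X i fun s =>
          X i s * ((leftUnf (X i) - leftUnf (V i))ᵀ * (leftUnf (X i) - leftUnf (V i))))) +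
      c ^ 2 * frobSq (leftUnf (gradient (loss A (A T)) X i)) := by
  set G := leftUnf (gradient (loss A (A T)) X i) with hG
  set E := leftUnf (X i) - leftUnf (V i) with hE
  have hXi := hX i hi
  have hVi := hV i hi
  -- The retraction is removed first; expanding the square of the tangent step is then exact, and
  -- the projected gradient is bounded by the full one.
  obtain ⟨h1, h2⟩ := frobSq_retract_sub_le _ (leftUnf (V i))
    (posSemidef_sub_smul_tangentProj (leftUnf (X i)) G hXi c) hVi
  rw [← hX'] at h1 h2
  refine ⟨h1, h2.trans ?_⟩
  have e1 : leftUnf (X i) - c • tangentProj (leftUnf (X i)) G - leftUnf (V i) =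
      E - c • tangentProj (leftUnf (X i)) G := by rw [hE]; abel
  have e2 : frobSq (c • tangentProj (leftUnf (X i)) G) =
      c ^ 2 * frobSq (tangentProj (leftUnf (X i)) G) := by
    simp [frobSq, mul_pow, Finset.mul_sum]
  have e3 : ((c • tangentProj (leftUnf (X i)) G)ᵀ * E).trace =
      c * ((tangentProj (leftUnf (X i)) E)ᵀ * G).trace := by
    rw [← trace_transpose_mul_tangentProj, ← Matrix.trace_transpose, Matrix.transpose_mul,
      Matrix.transpose_transpose, Matrix.mul_smul, Matrix.trace_smul, smul_eq_mul]
  have e4 : tangentProj (leftUnf (X i)) E =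
      leftUnf ((X i - V i) - (1 / 2 : ℝ) • fun s => X i s * (Eᵀ * E)) := by
    rw [hE, tangentProj_sub_stiefel _ _ hXi hVi]
    rfl
  rw [e1, frobSq_sub, e2, e3, e4, trace_gradient_mul, ← map_sub A, ← sensing_apply,
    map_sub (slotMap X i), map_smul (slotMap X i), map_sub (sensing A (toTensor X - T)),
    map_smul (sensing A (toTensor X - T)), smul_eq_mul]
  have h3 := mul_le_mul_of_nonneg_left (frobSq_tangentProj_le (leftUnf (X i)) G hXi) (sq_nonneg c)
  linarith

theorem frobSq_gradient_step {X V X' : Factors d r}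
    (A : Tensor d →ₗ[ℝ] EuclideanSpace ℝ (Fin m)) (T : Tensor d) (c : ℝ) (i : Fin N)
    (hX' : leftUnf (X' i) = leftUnf (X i) - c • leftUnf (gradient (loss A (A T)) X i)) :
    frobSq (leftUnf (X' i) - leftUnf (V i)) = frobSq (leftUnf (X i) - leftUnf (V i)) -
      2 * c * sensing A (toTensor X - T) (slotMap X i (X i - V i)) +
      c ^ 2 * frobSq (leftUnf (gradient (loss A (A T)) X i)) := by
  set G := leftUnf (gradient (loss A (A T)) X i) with hG
  have e1 : leftUnf (X i) - c • G - leftUnf (V i) = leftUnf (X i - V i) - c • G := by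
    rw [sub_right_comm]; rfl
  have e2 : frobSq (c • G) = c ^ 2 * frobSq G := by
    simp [frobSq, mul_pow, Finset.mul_sum]
  have e3 : ((c • G)ᵀ * leftUnf (X i - V i)).trace =
      c * ((leftUnf (X i - V i))ᵀ * G).trace := by
    rw [← Matrix.trace_transpose, Matrix.transpose_mul,
      Matrix.transpose_transpose, Matrix.mul_smul, Matrix.trace_smul, smul_eq_mul]
  rw [hX', e1, frobSq_sub, e2, e3, trace_gradient_mul, ← map_sub A, ← sensing_apply]
  rw [show leftUnf (X i - V i) = leftUnf (X i) - leftUnf (V i) from rfl]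
  ring

/-- Pairing the gradient with itself gives `‖G‖² ≤ κ ‖slotMap X i G‖ ≤ κ √b ‖G‖`, and one factor
`‖G‖` cancels. -/
theorem frobSq_gradient_le (hN : 0 < N) {X : Factors d r} (hX : IsLeftOrthogonal X)
    (A : Tensor d →ₗ[ℝ] EuclideanSpace ℝ (Fin m)) (T : Tensor d) {κ b : ℝ}
    (hb : 0 ≤ b) (i : Fin N)
    (hA : ∀ F : Factors d r, |sensing A (toTensor X - T) (toTensor F)| ≤ κ * ‖toTensor F‖)
    (hXb : (if (i : ℕ) + 1 < N then frobSq (leftUnf (X (lastIdx hN))) else 1) ≤ b) :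
    frobSq (leftUnf (gradient (loss A (A T)) X i)) ≤ κ ^ 2 * b := by
  set G := gradient (loss A (A T)) X i with hG
  have h1 : frobSq (leftUnf G) = sensing A (toTensor X - T) (slotMap X i G) := by
    rw [frobSq_eq_trace, hG, trace_gradient_mul, ← map_sub A, sensing_apply]
  have h2 : frobSq (leftUnf G) ≤ κ * ‖slotMap X i G‖ := by
    rw [h1]; exact (le_abs_self _).trans (hA _)
  have h3 : ‖slotMap X i G‖ ^ 2 ≤ frobSq (leftUnf G) * b :=
    (norm_slotMap_sq_le hN hX i G).trans (mul_le_mul_of_nonneg_left hXb (frobSq_nonneg _))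
  have h0 := frobSq_nonneg (leftUnf G)
  rcases h0.eq_or_lt with h | h
  · rw [← h]; positivity
  · have h4 : frobSq (leftUnf G) ^ 2 ≤ κ ^ 2 * (frobSq (leftUnf G) * b) :=
      calc frobSq (leftUnf G) ^ 2 ≤ (κ * ‖slotMap X i G‖) ^ 2 := pow_le_pow_left₀ h0 h2 2
        _ = κ ^ 2 * ‖slotMap X i G‖ ^ 2 := mul_pow _ _ _
        _ ≤ _ := mul_le_mul_of_nonneg_left h3 (sq_nonneg _)
    nlinarith

/-- Young's inequality with weights chosen so that an error of at most `1/5` of the squared norm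
keeps the total at `9/4`. -/
theorem frobSq_le_of_sub {m n : Type} [Fintype m] [Fintype n] (A B : Matrix m n ℝ) :
    frobSq A ≤ 5 / 4 * frobSq B + 5 * frobSq (A - B) := by
  simp only [frobSq, Finset.mul_sum, ← Finset.sum_add_distrib]
  refine Finset.sum_le_sum fun a _ => Finset.sum_le_sum fun b _ => ?_
  rw [Matrix.sub_apply]
  nlinarith [sq_nonneg (4 * A a b - 5 * B a b)]

theorem sq_sum_eq (e : Fin N → ℝ) :
    ∑ i, ∑ j, (if j < i then e j * e i else 0) + 1 / 2 * ∑ i, e i ^ 2 = 1 / 2 * (∑ i, e i) ^ 2 := by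
  have h1 : (∑ i, e i) ^ 2 = ∑ i, ∑ j, e j * e i := by
    rw [sq, Finset.sum_mul_sum, Finset.sum_comm]
  have h2 : ∀ i j : Fin N, e j * e i = (if j < i then e j * e i else 0) +
      (if i < j then e j * e i else 0) + (if j = i then e i ^ 2 else 0) := by
    intro i j
    rcases lt_trichotomy i j with h | rfl | h
    · simp [h, h.asymm, h.ne']
    · simp [sq]
    · simp [h, h.asymm, h.ne]
  have h3 : ∑ i, ∑ j, (if i < j then e j * e i else 0) =
      ∑ i, ∑ j, (if j < i then e j * e i else 0) := by
    rw [Finset.sum_comm]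
    simp only [mul_comm]
  have h4 : ∑ i, ∑ j, e j * e i = ∑ i, ∑ j, ((if j < i then e j * e i else 0) +
      (if i < j then e j * e i else 0) + (if j = i then e i ^ 2 else 0)) :=
    Finset.sum_congr rfl fun i _ => Finset.sum_congr rfl fun j _ => h2 i j
  rw [h1, h4]
  simp only [Finset.sum_add_distrib, h3, Finset.sum_ite_eq', Finset.mem_univ,
    if_true]
  ring

/-- Second order terms in the expansion of the loss along the aligned direction. -/
theorem sensing_lower_bound (hN : 0 < N) {X V : Factors d r} (hX : IsLeftOrthogonal X)
    (hV : IsLeftOrthogonal V) (A : Tensor d →ₗ[ℝ] EuclideanSpace ℝ (Fin m)) {κ s : ℝ}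
    (hκ : 0 ≤ κ) (hs : 0 < s) (hVs : ‖toTensor V‖ ^ 2 = s)
    (hXs : frobSq (leftUnf (X (lastIdx hN))) ≤ 9 / 4 * s)
    (hA : ∀ F : Factors d r, |sensing A (toTensor X - toTensor V) (toTensor F)| ≤ κ * ‖toTensor F‖) :
    sensing A (toTensor X - toTensor V) (toTensor X - toTensor V) -
        3 / 4 * κ * (N * costSq X V / √s) ≤
      ∑ i : Fin N, (sensing A (toTensor X - toTensor V) (slotMap X i (X i - V i)) -
        if (i : ℕ) + 1 < N then
          1 / 2 * sensing A (toTensor X - toTensor V) (slotMap X i fun s =>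
          X i s * ((leftUnf (X i) - leftUnf (V i))ᵀ * (leftUnf (X i) - leftUnf (V i)))) else 0) := by
  set H := toTensor X - toTensor V with hH
  set w : Fin N → ℝ := fun i => if (i : ℕ) + 1 < N then s else 1 with hw
  have hw0 : ∀ i, 0 ≤ w i := fun i => by simp only [hw]; split_ifs <;> positivity
  set e : Fin N → ℝ := fun i => √(w i * frobSq (leftUnf (X i) - leftUnf (V i))) with he
  have he0 : ∀ i, 0 ≤ e i := fun i => Real.sqrt_nonneg _
  have he2 : ∀ i, e i ^ 2 = w i * frobSq (leftUnf (X i) - leftUnf (V i)) := fun i =>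
    Real.sq_sqrt (mul_nonneg (hw0 i) (frobSq_nonneg _))
  have hcost : ∑ i, e i ^ 2 = costSq X V := by
    simp only [he2, costSq, hVs, hw]
  have hXw : ∀ i : Fin N, (if (i : ℕ) + 1 < N then frobSq (leftUnf (X (lastIdx hN))) else 1) ≤
      9 / 4 * w i := fun i => by
    simp only [hw]; split_ifs
    · exact hXs
    · norm_num
  have hss : √s ^ 2 = s := Real.sq_sqrt hs.le
  have hsp : 0 < √s := Real.sqrt_pos.mpr hs
  have hm : ∀ i j : Fin N, j < i →
      ‖slotMap (splice j V (Function.update X i (X i - V i))) j (X j - V j)‖ ≤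
        3 / 2 * (e j * e i) / √s := by
    intro i j hij
    refine abs_le_of_sq_le_sq' ?_ (by have := he0 i; have := he0 j; positivity) |>.2
    refine (norm_slotMap_splice_sq_le hN hX hV hij _ _).trans ?_
    have h1 : w j = s := by
      have := i.2; have : (j : ℕ) < i := hij
      simp only [hw]; rw [if_pos (by omega)]
    have e1 : (3 / 2 * (e j * e i) / √s) ^ 2 = frobSq (leftUnf (X j - V j)) *
        (frobSq (leftUnf (X i - V i)) * (9 / 4 * w i)) := by
      rw [div_pow, hss, mul_pow, mul_pow, he2, he2, h1]
      change _ = frobSq (leftUnf (X j) - leftUnf (V j)) *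
        (frobSq (leftUnf (X i) - leftUnf (V i)) * _)
      field_simp
      ring
    rw [e1]
    exact mul_le_mul_of_nonneg_left (mul_le_mul_of_nonneg_left (hXw i) (frobSq_nonneg _))
      (frobSq_nonneg _)
  have hq : ∀ i : Fin N, (i : ℕ) + 1 < N → ‖slotMap X i fun s =>
      X i s * ((leftUnf (X i) - leftUnf (V i))ᵀ * (leftUnf (X i) - leftUnf (V i)))‖ ≤
        3 / 2 * e i ^ 2 / √s := by
    intro i hi
    refine abs_le_of_sq_le_sq' ?_ (by have := he0 i; positivity) |>.2
    refine (norm_slotMap_sq_le hN hX i _).trans ?_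
    have h1 : w i = s := by simp only [hw]; rw [if_pos hi]
    set E := leftUnf (X i) - leftUnf (V i) with hE
    have h2 : frobSq (leftUnf fun s => X i s * (Eᵀ * E)) ≤ frobSq E ^ 2 := by
      have h3 : frobSq (leftUnf (X i) * (Eᵀ * E)) = frobSq (Eᵀ * E) := by
        rw [frobSq_eq_trace, frobSq_eq_trace, Matrix.transpose_mul, Matrix.mul_assoc,
          ← Matrix.mul_assoc (leftUnf (X i))ᵀ, hX i hi, Matrix.one_mul]
      have h4 : frobSq Eᵀ = frobSq E := by
        simp only [frobSq, Matrix.transpose_apply]; exact Finset.sum_comm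
      rw [leftUnf_mul, h3, sq]
      nth_rewrite 2 [← h4]
      rw [mul_comm]
      exact frobSq_mul_le _ _
    have e1 : (3 / 2 * e i ^ 2 / √s) ^ 2 = frobSq E ^ 2 * (9 / 4 * w i) := by
      rw [div_pow, hss, mul_pow, he2, h1, ← hE]
      field_simp
      ring
    rw [e1]
    refine mul_le_mul h2 (hXw i) ?_ (sq_nonneg _)
    split_ifs
    · exact frobSq_nonneg _
  have hlow1 : ∀ i j : Fin N, -(κ * (3 / 2) / √s * (if j < i then e j * e i else 0)) ≤
      sensing A H (if j < i then
        slotMap (splice j V (Function.update X i (X i - V i))) j (X j - V j) else 0) := by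
    intro i j
    split_ifs with hij
    · have h2 := mul_le_mul_of_nonneg_left (hm i j hij) hκ
      refine le_trans ?_ (abs_le.mp (hA _)).1
      rw [← slotMap_apply]
      have e1 : κ * (3 / 2) / √s * (e j * e i) = κ * (3 / 2 * (e j * e i) / √s) := by ring
      rw [e1]
      linarith
    · simp
  have hlow2 : ∀ i : Fin N, (if (i : ℕ) + 1 < N then
          1 / 2 * sensing A H (slotMap X i fun s =>
          X i s * ((leftUnf (X i) - leftUnf (V i))ᵀ * (leftUnf (X i) - leftUnf (V i)))) else 0) ≤
      κ * (3 / 2) / √s * (1 / 2 * e i ^ 2) := by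
    intro i
    split_ifs with hi
    · have h2 := mul_le_mul_of_nonneg_left (hq i hi) hκ
      have h1 := (abs_le.mp (hA (Function.update X i fun s =>
          X i s * ((leftUnf (X i) - leftUnf (V i))ᵀ * (leftUnf (X i) - leftUnf (V i)))))).2
      rw [← slotMap_apply] at h1
      have e1 : κ * (3 / 2) / √s * (1 / 2 * e i ^ 2) = 1 / 2 * (κ * (3 / 2 * e i ^ 2 / √s)) := by
        ring
      rw [e1]
      linarith
    · have := he0 i
      positivity
  rw [Finset.sum_sub_distrib, ← map_sum, sum_slotMap_eq, map_add]
  simp only [map_sum]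
  have h1 : -(κ * (3 / 2) / √s * ∑ i, ∑ j, (if j < i then e j * e i else 0)) ≤
      ∑ i : Fin N, ∑ j : Fin N, sensing A H (if j < i then
        slotMap (splice j V (Function.update X i (X i - V i))) j (X j - V j) else 0) := by
    simp only [Finset.mul_sum, ← Finset.sum_neg_distrib]
    exact Finset.sum_le_sum fun i _ => Finset.sum_le_sum fun j _ => hlow1 i j
  have h2 := Finset.sum_le_sum fun i (_ : i ∈ Finset.univ) => hlow2 i
  rw [← Finset.mul_sum, ← Finset.mul_sum] at h2
  -- The pairs `j < i` and half of the diagonal, coming from the tangent projection, complete to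
  -- half of a square. Cauchy–Schwarz then yields `3/2 * 1/2 = 3/4` times `N D / √s`.
  have h3 : (∑ i, e i) ^ 2 ≤ N * costSq X V := by
    rw [← hcost]
    simpa using sq_sum_le_card_mul_sum_sq (s := Finset.univ) (f := e)
  have h4 := sq_sum_eq e
  have h5 : κ * (3 / 2) / √s * (1 / 2 * (∑ i, e i) ^ 2) ≤ 3 / 4 * κ * (N * costSq X V / √s) := by
    have : 0 ≤ κ * (3 / 4) / √s := by positivity
    have := mul_le_mul_of_nonneg_left h3 this
    calc _ = κ * (3 / 4) / √s * (∑ i, e i) ^ 2 := by ring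
      _ ≤ _ := this
      _ = _ := by ring
  rw [← h4] at h5
  linarith

end Descent

/-! ### One-step contraction -/

section Convergence

variable {N : ℕ} {d : Fin N → ℕ} {r : Bonds N} {m : ℕ}

theorem frobSq_last_le (hN : 0 < N) {X V : Factors d r} (hV : IsLeftOrthogonal V)
    (hD : 5 * costSq X V ≤ ‖toTensor V‖ ^ 2) :
    frobSq (leftUnf (X (lastIdx hN))) ≤ 9 / 4 * ‖toTensor V‖ ^ 2 := by
  have hl : ¬ ((lastIdx hN : Fin N) : ℕ) + 1 < N := (eq_lastIdx hN _).mp rfl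
  have h1 := frobSq_le_of_sub (leftUnf (X (lastIdx hN))) (leftUnf (V (lastIdx hN)))
  rw [← norm_toTensor_sq_eq_frobSq hV (lastIdx hN) (by simp only [lastIdx]; omega)] at h1
  have h2 : frobSq (leftUnf (X (lastIdx hN)) - leftUnf (V (lastIdx hN))) ≤ costSq X V := by
    have := Finset.single_le_sum (f := fun i : Fin N =>
      (if (i : ℕ) + 1 < N then ‖toTensor V‖ ^ 2 else 1) * frobSq (leftUnf (X i) - leftUnf (V i)))
      (fun i _ => mul_nonneg (by split_ifs <;> positivity) (frobSq_nonneg _))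
      (Finset.mem_univ (lastIdx hN))
    simp only [if_neg hl, one_mul] at this
    exact this
  linarith

/-- Each telescoping term costs at most `9/4` of its weighted factor error, and Cauchy–Schwarz over
the `N` terms supplies the factor `N`. -/
theorem norm_toTensor_sub_sq_le (hN : 0 < N) {X V : Factors d r} (hX : IsLeftOrthogonal X)
    (hV : IsLeftOrthogonal V)
    (hXs : frobSq (leftUnf (X (lastIdx hN))) ≤ 9 / 4 * ‖toTensor V‖ ^ 2) :
    ‖toTensor X - toTensor V‖ ^ 2 ≤ 9 / 4 * (N * costSq X V) := by
  have h1 : ∀ j : Fin N, ‖slotMap (splice j V X) j (X j - V j)‖ ^ 2 ≤ 9 / 4 *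
      ((if (j : ℕ) + 1 < N then ‖toTensor V‖ ^ 2 else 1) *
        frobSq (leftUnf (X j) - leftUnf (V j))) := by
    intro j
    refine (norm_slotMap_sq_le hN (isLeftOrthogonal_splice hX hV j) j _).trans ?_
    rw [mul_comm, ← mul_assoc]
    refine mul_le_mul_of_nonneg_right ?_ (frobSq_nonneg _)
    split_ifs with hj
    · have : splice j V X (lastIdx hN) = X (lastIdx hN) := by
        rw [splice, if_neg (by simp only [lastIdx]; omega)]
      rw [this]; exact hXs
    · norm_num
  rw [toTensor_sub_toTensor]
  calc _ ≤ (∑ j : Fin N, ‖slotMap (splice j V X) j (X j - V j)‖) ^ 2 :=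
        pow_le_pow_left₀ (norm_nonneg _) (norm_sum_le _ _) 2
    _ ≤ N * ∑ j : Fin N, ‖slotMap (splice j V X) j (X j - V j)‖ ^ 2 := by
        simpa using sq_sum_le_card_mul_sum_sq (s := Finset.univ)
          (f := fun j : Fin N => ‖slotMap (splice j V X) j (X j - V j)‖)
    _ ≤ N * (9 / 4 * costSq X V) := by
        refine mul_le_mul_of_nonneg_left ?_ (Nat.cast_nonneg _)
        rw [costSq, Finset.mul_sum]
        exact Finset.sum_le_sum fun j _ => h1 j
    _ = _ := by ring

/-- One step of the iteration decreases the weighted distance to fixed left-orthogonal factors. -/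
theorem costSq_step_le (hN : 0 < N) {X V X' : Factors d r} (hX : IsLeftOrthogonal X)
    (hV : IsLeftOrthogonal V) (A : Tensor d →ₗ[ℝ] EuclideanSpace ℝ (Fin m)) {κ μ : ℝ}
    (hκ : 0 ≤ κ) (hμ : 0 ≤ μ) (hs : 0 < ‖toTensor V‖ ^ 2)
    (hXs : frobSq (leftUnf (X (lastIdx hN))) ≤ 9 / 4 * ‖toTensor V‖ ^ 2)
    (hA : ∀ F : Factors d r, |sensing A (toTensor X - toTensor V) (toTensor F)| ≤ κ * ‖toTensor F‖)
    (hstep : ∀ i : Fin N,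
      ((i : ℕ) + 1 < N → leftUnf (X' i) = retract (leftUnf (X i) - (μ / ‖toTensor V‖ ^ 2) •
        tangentProj (leftUnf (X i)) (leftUnf (gradient (loss A (A (toTensor V))) X i)))) ∧
      ((i : ℕ) + 1 = N → leftUnf (X' i) = leftUnf (X i) -
        μ • leftUnf (gradient (loss A (A (toTensor V))) X i))) :
    costSq X' V ≤ costSq X V -
      2 * μ * (sensing A (toTensor X - toTensor V) (toTensor X - toTensor V) -
        3 / 4 * κ * (N * costSq X V / √(‖toTensor V‖ ^ 2))) +
      N * (μ ^ 2 * (9 / 4 * κ ^ 2)) := by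
  have h := sensing_lower_bound hN hX hV A hκ hs rfl hXs hA
  set s := ‖toTensor V‖ ^ 2 with hsdef
  set H := toTensor X - toTensor V with hH
  set b : Fin N → ℝ := fun i => sensing A H (slotMap X i (X i - V i)) -
        if (i : ℕ) + 1 < N then
          1 / 2 * sensing A H (slotMap X i fun s =>
          X i s * ((leftUnf (X i) - leftUnf (V i))ᵀ * (leftUnf (X i) - leftUnf (V i)))) else 0
    with hb
  have hi : ∀ i : Fin N, (if (i : ℕ) + 1 < N then s else 1) *
      frobSq (leftUnf (X' i) - leftUnf (V i)) ≤ (if (i : ℕ) + 1 < N then s else 1) *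
      frobSq (leftUnf (X i) - leftUnf (V i)) - 2 * μ * b i + μ ^ 2 * (9 / 4 * κ ^ 2) := by
    intro i
    have hG := frobSq_gradient_le hN hX A (toTensor V) (κ := κ)
      (b := 9 / 4 * if (i : ℕ) + 1 < N then s else 1) (by split_ifs <;> positivity) i hA
      (by split_ifs
          · exact hXs
          · norm_num)
    simp only [hb]
    by_cases hi : (i : ℕ) + 1 < N
    · have h1 := (frobSq_retract_step_le hX hV A (toTensor V) (μ / s) i hi ((hstep i).1 hi)).2
      simp only [if_pos hi] at hG ⊢
      have h2 := mul_le_mul_of_nonneg_left h1 hs.le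
      refine h2.trans ?_
      -- The weight `s`, the step `μ / s` and a squared gradient of order `s` balance, so all
      -- factors contribute the same quadratic term in `μ`.
      have h3 : (μ / s) ^ 2 * s * frobSq (leftUnf (gradient (loss A (A (toTensor V))) X i)) ≤
          (μ / s) ^ 2 * s * (κ ^ 2 * (9 / 4 * s)) :=
        mul_le_mul_of_nonneg_left hG (by positivity)
      have e1 : (μ / s) ^ 2 * s * (κ ^ 2 * (9 / 4 * s)) = μ ^ 2 * (9 / 4 * κ ^ 2) := by
        field_simp
      have e2 : s * (2 * (μ / s)) = 2 * μ := by field_simp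
      rw [e1] at h3
      rw [← e2]
      linarith
    · have hi' : (i : ℕ) + 1 = N := by have := i.2; omega
      have h1 := frobSq_gradient_step (V := V) A (toTensor V) μ i ((hstep i).2 hi')
      simp only [if_neg hi] at hG ⊢
      rw [one_mul, one_mul, h1, sub_zero]
      have h3 := mul_le_mul_of_nonneg_left hG (sq_nonneg μ)
      linarith
  have hsum := Finset.sum_le_sum fun i (_ : i ∈ Finset.univ) => hi i
  rw [Finset.sum_add_distrib, Finset.sum_sub_distrib, ← Finset.mul_sum, Finset.sum_const,
    Finset.card_univ, Fintype.card_fin, nsmul_eq_mul] at hsum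
  have h2 := mul_le_mul_of_nonneg_left h (by positivity : 0 ≤ 2 * μ)
  change costSq X' V ≤ costSq X V - _ + _ at hsum
  linarith

theorem isLeftOrthogonal_step {X X' : Factors d r} (hX : IsLeftOrthogonal X) {c : ℝ}
    (G : Factors d r)
    (hstep : ∀ i : Fin N, (i : ℕ) + 1 < N → leftUnf (X' i) = retract (leftUnf (X i) -
      c • tangentProj (leftUnf (X i)) (leftUnf (G i)))) : IsLeftOrthogonal X' := by
  intro i hi
  rw [hstep i hi]
  -- The comparison point is irrelevant here; the current factor is a convenient Stiefel point.
  exact (frobSq_retract_sub_le _ (leftUnf (X i))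
    (posSemidef_sub_smul_tangentProj _ _ (hX i hi) c) (hX i hi)).1

/-- Local linear convergence of Riemannian gradient descent: one step. -/
theorem distSq_step_le (hN : 2 ≤ N) {X X' Y : Factors d r} (hX : IsLeftOrthogonal X)
    (hY : IsLeftOrthogonal Y) (hmin : IsMinimal Y)
    {A : Tensor d →ₗ[ℝ] EuclideanSpace ℝ (Fin m)} {δ μ : ℝ}
    (hA : HasRIP A ((N + 3) * r.maxRank) δ) (hδ0 : 0 ≤ δ) (hδ : δ ≤ 4 / 15) (hμ0 : 0 < μ)
    (hμ : μ ≤ (4 - 15 * δ) / (10 * (9 * (N : ℝ) - 5) * (1 + δ) ^ 2))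
    (hstep : ∀ i : Fin N,
      ((i : ℕ) + 1 < N → leftUnf (X' i) = retract (leftUnf (X i) - (μ / ‖toTensor Y‖ ^ 2) •
        tangentProj (leftUnf (X i)) (leftUnf (gradient (loss A (A (toTensor Y))) X i)))) ∧
      ((i : ℕ) + 1 = N → leftUnf (X' i) = leftUnf (X i) -
        μ • leftUnf (gradient (loss A (A (toTensor Y))) X i)))
    (hD : 114 * ((N : ℝ) + 1 + r.innerSum) * (N : ℝ) ^ 2 * distSq X Y ≤
      sigmaMin r (toTensor Y) ^ 2) :
    distSq X' Y ≤ (1 - (4 - 15 * δ) * sigmaMin r (toTensor Y) ^ 2 /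
      (320 * ((N : ℝ) + 1 + r.innerSum) * ‖toTensor Y‖ ^ 2) * μ) * distSq X Y := by
  have hN0 : 0 < N := by omega
  have hσ0 : 0 < sigmaMin r (toTensor Y) := sigmaMin_pos hN hmin hY
  have hσs : sigmaMin r (toTensor Y) ^ 2 ≤ ‖toTensor Y‖ ^ 2 := sigmaMin_sq_le hN hmin hY
  obtain ⟨R, hR⟩ := exists_distSq_eq X Y
  set V := rotate R Y with hVdef
  have hV : IsLeftOrthogonal V := isLeftOrthogonal_rotate R hY
  have hVT : toTensor V = toTensor Y := toTensor_rotate R Y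
  set D := costSq X V with hDdef
  have hD0 : 0 ≤ D := costSq_nonneg X V
  set σ := sigmaMin r (toTensor Y) with hσ
  set s := ‖toTensor Y‖ ^ 2 with hs
  set Q : ℝ := (N : ℝ) + 1 + r.innerSum with hQ
  have hn : (2 : ℝ) ≤ N := by exact_mod_cast hN
  have hQ3 : 3 ≤ Q := by
    have : (0 : ℝ) ≤ r.innerSum := Nat.cast_nonneg _
    rw [hQ]; linarith
  have hσ2 : 0 < σ ^ 2 := by positivity
  have hs0 : 0 < s := hσ2.trans_le hσs
  rw [hR] at hD ⊢
  -- Crude form of the smallness condition, from `Q ≥ 3` and `N ≥ 2`. It secures the `9/4` norm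
  -- bound and `h² < σ²`, which the reverse bound requires.
  have hND : (N : ℝ) * D * (114 * 3 * 2) ≤ σ ^ 2 := by
    refine le_trans ?_ hD
    have h1 : (3 : ℝ) * 2 ≤ Q * N := mul_le_mul hQ3 hn (by norm_num) (by linarith)
    have h2 := mul_le_mul_of_nonneg_right h1 (by positivity : 0 ≤ 114 * (N * D))
    nlinarith
  have h2D : 2 * D ≤ N * D := mul_le_mul_of_nonneg_right hn hD0
  have hXs : frobSq (leftUnf (X (lastIdx hN0))) ≤ 9 / 4 * ‖toTensor V‖ ^ 2 := by
    refine frobSq_last_le hN0 hV ?_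
    rw [hVT]
    linarith
  have hη1 := norm_toTensor_sub_sq_le hN0 hX hV hXs
  have hlow := sq_mul_distSq_le hN hX hY hmin (by
    rw [norm_toTensor_sq_eq_frobSq hX (lastIdx hN0) (by simp only [lastIdx]; omega), ← hVT]
    exact hXs) (by
    rw [← hVT]; refine hη1.trans_lt ?_
    rw [hVT, ← hσ]
    linarith)
  rw [← hσ, ← hs, ← hQ, hR] at hlow
  have hrip := hA.of_sub hN0 X Y
  set h := ‖toTensor X - toTensor Y‖ with hh
  have hh0 : 0 ≤ h := norm_nonneg _
  have hstep' := costSq_step_le hN0 (X' := X') hX hV A (κ := (1 + δ) * h) (μ := μ) (by positivity)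
    hμ0.le (by rw [hVT]; exact hs0) hXs
    (fun F => by
      rw [hVT, sensing_apply]
      exact abs_inner_le_of_sq_le A (by linarith) hrip.2 (hA.of_factors F).2)
    (by rw [hVT]; exact hstep)
  rw [hVT, ← hs, sensing_apply, real_inner_self_eq_norm_sq] at hstep'
  have hsq : 0 < √s := Real.sqrt_pos.mpr hs0
  have hss : √s ^ 2 = s := Real.sq_sqrt hs0.le
  -- Multiplying the smallness condition by `D` and inserting the reverse bound gives `(N D)² ≤
  -- (4/57) s h²`, and `√(4/57) < 53/200`.
  have hcurv : N * D / √s ≤ 53 / 200 * h := by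
    refine abs_le_of_sq_le_sq' ?_ (by positivity) |>.2
    rw [div_pow, hss, div_le_iff₀ hs0]
    have h1 := mul_le_mul_of_nonneg_left hD hD0
    have h2 : D * (114 * Q * N ^ 2 * D) ≤ 8 * Q * s * h ^ 2 := by linarith
    have h3 : Q * (57 * (N * D) ^ 2) ≤ Q * (4 * (s * h ^ 2)) := by linarith
    have h4 := le_of_mul_le_mul_left h3 (by linarith)
    have h5 : 0 ≤ s * h ^ 2 := by positivity
    linarith
  -- For `N ≥ 2` one has `9 N ≤ 7/5 * (9 N - 5)`, so the step bound gives `1/4 * 7/5 * 4/10 = 7/50`.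
  have hμ2 : μ * (1 + δ) ^ 2 * (9 / 4 * N) ≤ 7 / 50 := by
    have h9 : 0 < 9 * (N : ℝ) - 5 := by linarith
    rw [le_div_iff₀ (by positivity)] at hμ
    have h1 : μ * (1 + δ) ^ 2 * (10 * (9 * (N : ℝ) - 5)) ≤ 4 := by linarith
    have h0 : 0 ≤ μ * (1 + δ) ^ 2 := by positivity
    have h2 := mul_le_mul_of_nonneg_left (by linarith : 9 * (N : ℝ) ≤ 7 / 5 * (9 * N - 5)) h0
    linarith
  have hmain : costSq X' V ≤ D - 1 / 10 * (μ * h ^ 2) := by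
    have h1 : 3 / 4 * ((1 + δ) * h) * (N * D / √s) ≤ 3 / 4 * ((1 + δ) * h) * (53 / 200 * h) :=
      mul_le_mul_of_nonneg_left hcurv (by positivity)
    -- The left-over curvature decreases in `δ`; at `δ = 4/15` it is still slightly above `0.48`.
    have h2 : 12 / 25 * h ^ 2 ≤ (1 - δ) * h ^ 2 - 3 / 4 * ((1 + δ) * h) * (53 / 200 * h) := by
      nlinarith [mul_nonneg (by linarith : (0 : ℝ) ≤ 4 / 15 - δ) (sq_nonneg h), sq_nonneg h]
    have h3 : 12 / 25 * h ^ 2 ≤ 1 / (m : ℝ) * ‖A (toTensor X - toTensor Y)‖ ^ 2 -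
        3 / 4 * ((1 + δ) * h) * (N * D / √s) := by linarith [hrip.1]
    have h4 := mul_le_mul_of_nonneg_left h3 (by positivity : 0 ≤ 2 * μ)
    have h5 : 0 ≤ μ * h ^ 2 := by positivity
    have h6 := mul_le_mul_of_nonneg_right hμ2 h5
    have e : N * (μ ^ 2 * (9 / 4 * ((1 + δ) * h) ^ 2)) =
        μ * (1 + δ) ^ 2 * (9 / 4 * N) * (μ * h ^ 2) := by ring
    rw [e] at hstep'
    linarith
  refine (distSq_le X' Y R).trans (hmain.trans ?_)
  -- Second use of the reverse bound: with `4 - 15 δ ≤ 4`, the claimed decrease is at most `4 * 8 /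
  -- 320 = 1/10` of `μ h²`.
  have hq : (4 - 15 * δ) * σ ^ 2 / (320 * Q * s) * μ * D ≤ 1 / 10 * (μ * h ^ 2) := by
    have e : (4 - 15 * δ) * σ ^ 2 / (320 * Q * s) * μ * D =
        (4 - 15 * δ) * μ * (σ ^ 2 * D) / (320 * Q * s) := by ring
    rw [e, div_le_iff₀ (by positivity)]
    have h1 : 0 ≤ (4 - 15 * δ) * μ := mul_nonneg (by linarith) hμ0.le
    have h2 := mul_le_mul_of_nonneg_left hlow h1
    have h3 : (4 - 15 * δ) * μ * (8 * Q * s * h ^ 2) ≤ 4 * μ * (8 * Q * s * h ^ 2) :=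
      mul_le_mul_of_nonneg_right (mul_le_mul_of_nonneg_right (by linarith) hμ0.le) (by positivity)
    linarith
  linarith

end Convergence
end TT

end

/-! ### Linear convergence -/

theorem mainTheorem2 {N : ℕ} (hN : 2 ≤ N) (d : Fin N → ℕ) (r : TT.Bonds N) (m : ℕ)
    (A : TT.Tensor d →ₗ[ℝ] EuclideanSpace ℝ (Fin m))
    (Xstar : TT.Tensor d) (Xs : TT.Factors d r) (hXs : TT.toTensor Xs = Xstar)
    (hmin : TT.IsMinimal Xs) (hleft : TT.IsLeftOrthogonal Xs)
    (δ : ℝ) (hRIP : TT.HasRIP A ((N + 3) * r.maxRank) δ) (hδ : δ ≤ 4 / 15)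
    (y : EuclideanSpace ℝ (Fin m)) (hy : y = A Xstar)
    (μ : ℝ) (hμpos : 0 < μ)
    (hμ : μ ≤ (4 - 15 * δ) / (10 * (9 * (N : ℝ) - 5) * (1 + δ) ^ 2))
    (X : ℕ → TT.Factors d r) (hX0 : TT.IsLeftOrthogonal (X 0))
    (hRGD : TT.IsRGD (TT.loss A y) (‖Xstar‖ ^ 2) μ X)
    (hinit : TT.distSq (X 0) Xs ≤
      (4 - 15 * δ) * TT.sigmaMin r Xstar ^ 2 /
        (8 * ((N : ℝ) + 1 + r.innerSum) * (57 * (N : ℝ) ^ 2 + 393 * N - 450))) :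
    (0 ≤ 1 - (4 - 15 * δ) * TT.sigmaMin r Xstar ^ 2 /
          (320 * ((N : ℝ) + 1 + r.innerSum) * ‖Xstar‖ ^ 2) * μ ∧
      1 - (4 - 15 * δ) * TT.sigmaMin r Xstar ^ 2 /
          (320 * ((N : ℝ) + 1 + r.innerSum) * ‖Xstar‖ ^ 2) * μ < 1) ∧
    ∀ t : ℕ, TT.distSq (X (t + 1)) Xs ≤
      (1 - (4 - 15 * δ) * TT.sigmaMin r Xstar ^ 2 /
          (320 * ((N : ℝ) + 1 + r.innerSum) * ‖Xstar‖ ^ 2) * μ) * TT.distSq (X t) Xs := by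
  subst hXs hy
  have hN' : (2 : ℝ) ≤ N := by exact_mod_cast hN
  have hS : (0 : ℝ) ≤ r.innerSum := Nat.cast_nonneg _
  have hσ := TT.sigmaMin_pos hN hmin hleft
  have hσs := TT.sigmaMin_sq_le hN hmin hleft
  set σ := TT.sigmaMin r (TT.toTensor Xs)
  set s := ‖TT.toTensor Xs‖ ^ 2
  set Q : ℝ := (N : ℝ) + 1 + r.innerSum with hQ
  have hQ3 : 3 ≤ Q := by linarith
  have hσ2 : 0 < σ ^ 2 := by positivity
  have hs : 0 < s := hσ2.trans_le hσs
  -- The two isometry bounds on the nonzero target tensor force `1 - δ ≤ 1 + δ`.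
  have hδ0 : 0 ≤ δ := by
    have h := hRIP.of_factors Xs
    nlinarith [h.1.trans h.2]
  have h9 : 0 < 9 * (N : ℝ) - 5 := by linarith
  -- Strict, since `δ = 4/15` would leave no positive step size.
  have hδ4 : 0 < 4 - 15 * δ := by
    have h1 := hμpos.trans_le hμ
    by_contra h2
    exact absurd h1 (not_lt.mpr (div_nonpos_of_nonpos_of_nonneg (by linarith) (by positivity)))
  have hμ1 : μ ≤ 1 := by
    refine hμ.trans ((div_le_one (by positivity)).mpr ?_)
    nlinarith [sq_nonneg δ]
  have hq0 : 0 < (4 - 15 * δ) * σ ^ 2 / (320 * Q * s) * μ := by positivity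
  have hq1 : (4 - 15 * δ) * σ ^ 2 / (320 * Q * s) * μ ≤ 1 := by
    refine mul_le_one₀ ((div_le_one (by positivity)).mpr ?_) hμpos.le hμ1
    calc (4 - 15 * δ) * σ ^ 2 ≤ 4 * s := mul_le_mul (by linarith) hσs hσ2.le (by norm_num)
      _ ≤ 320 * Q * s := mul_le_mul_of_nonneg_right (by linarith) hs.le
  refine ⟨⟨by linarith, by linarith⟩, ?_⟩
  -- The basin condition `114 Q N² dist² ≤ σ²` is invariant because the distance does not increase.
  have hinv : ∀ t, TT.IsLeftOrthogonal (X t) ∧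
      114 * Q * (N : ℝ) ^ 2 * TT.distSq (X t) Xs ≤ σ ^ 2 := by
    have hD0 : ∀ t, 0 ≤ TT.distSq (X t) Xs := fun t => by
      rw [TT.distSq_eq_iInf]
      exact Real.iInf_nonneg fun R => TT.costSq_nonneg _ _
    intro t
    induction t with
    | zero =>
      refine ⟨hX0, ?_⟩
      -- Keeping only `57 N²` (as `393 N ≥ 450`) and `4 - 15 δ ≤ 4`, the initial bound becomes `σ² /
      -- (114 Q N²)`.
      have hK : 57 * (N : ℝ) ^ 2 ≤ 57 * (N : ℝ) ^ 2 + 393 * N - 450 := by linarith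
      have hK0 : 0 < 57 * (N : ℝ) ^ 2 + 393 * N - 450 := lt_of_lt_of_le (by positivity) hK
      rw [le_div_iff₀ (by positivity)] at hinit
      have h1 := mul_le_mul_of_nonneg_left hK
        (by have := hD0 0; positivity : 0 ≤ TT.distSq (X 0) Xs * (8 * Q))
      have h2 : (4 - 15 * δ) * σ ^ 2 ≤ 4 * σ ^ 2 :=
        mul_le_mul_of_nonneg_right (by linarith) hσ2.le
      linarith
    | succ t ih =>
      refine ⟨TT.isLeftOrthogonal_step ih.1 _ fun i hi => (hRGD t i).1 hi, le_trans ?_ ih.2⟩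
      refine mul_le_mul_of_nonneg_left ?_ (by positivity)
      refine (TT.distSq_step_le hN ih.1 hleft hmin hRIP hδ0 hδ hμpos hμ (hRGD t) ih.2).trans ?_
      exact mul_le_of_le_one_left (hD0 t) (by linarith)
  intro t
  exact TT.distSq_step_le hN (hinv t).1 hleft hmin hRIP hδ0 hδ hμpos hμ (hRGD t) (hinv t).2
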